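/- Conventions. An order-unit space is a partially ordered real vector space $A$ with a distinguished element $e>0$ (so $e\neq 0$, $A\neq\{0\}$) such that (1) for each $a\in A$ there is $r\in\mathbb R$ with $a\le re$, and (2) if $a\le re$ for all $r>0$, then $a\le 0$. It carries the norm $\|a\|=\inf\{r\in\mathbb R:-re\le a\le re\}$; its state space $S(A)$ is the set of bounded linear functionals $\mu$ with $\mu(e)=1=\|\mu\|$, with the weak-$*$ topology. A Lip-norm on $A$ is a (finite) seminorm $L$ such that $L(a)=0$ iff $a\in\mathbb Re$, and such that the topology on $S(A)$ given by $\rho_L(\mu,\nu)=\sup\{|\mu(a)-\nu(a)|:L(a)\le 1\}$ is the weak-$*$ topology. A compact quantum metric space is a pair $(A,L)$ of an order-unit space and a Lip-norm on it. For compact quantum metric spaces $(A,L_A)$, $(B,L_B)$ let $\mathcal M(L_A,L_B)$ be the set of Lip-norms $L$ on $A\oplus B$ (componentwise order, order unit $(e_A,e_B)$) whose quotient seminorms on $A$ and $B$ under the two projections are $L_A$ and $L_B$. Put $$\mathrm{dist}_q(A,B)=\inf\{\mathrm{dist}_H^{\rho_L}(S(A),S(B)):L\in\mathcal M(L_A,L_B)\},$$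 where $S(A)$ and $S(B)$ are embedded in $S(A\oplus B)$ via the projections and $\mathrm{dist}_H^{\rho_L}$ is the Hausdorff distance for $\rho_L$. Let $\bar A$ be the norm completion of $A$, ordered by the closure of the positive cone of $A$. The closure $(A^c,L^c)$ of $(A,L)$ is the linear span $A^c\subseteq\bar A$ of the closure in $\bar A$ of $\{a\in A:L(a)\le 1\}$, with the seminorm $L^c$ which has this closure as its closed unit ball. An isometry from $(A,L_A)$ to $(B,L_B)$ is an isomorphism of order-unit spaces (a linear order isomorphism preserving the order units) $\varphi$ from $A^c$ onto $B^c$ with $L_A^c=L_B^c\circ\varphi$. Let $\mathcal Q$ be the set of isometry equivalence classes of compact quantum metric spaces. Theorem. $\mathrm{dist}_q$ induces a well-defined (finite) metric on $\mathcal Q$, and the metric space $(\mathcal Q,\mathrm{dist}_q)$ is separable. -/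

import Mathlib

open scoped ENNReal

universe u

/-- An order-unit space: a partially ordered real vector space `A` with a distinguished element `e`
(here `ordUnit`), `0 < e`, having the order unit property and the Archimedean property.
The norm is not extra data: `norm_eq` says that it is the order-unit norm
`‖a‖ = inf {r : -re ≤ a ≤ re}`, so that it is determined by the order and by `e`. -/
class OrderUnitSpace (A : Type*) [NormedAddCommGroup A] [NormedSpace ℝ A] [PartialOrder A]
    extends IsOrderedAddMonoid A, PosSMulMono ℝ A where
  ordUnit : A
  ordUnit_pos : 0 < ordUnit
  exists_le_smul : ∀ a : A, ∃ r : ℝ, a ≤ r • ordUnit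
  archimedean : ∀ a : A, (∀ r : ℝ, 0 < r → a ≤ r • ordUnit) → a ≤ 0
  norm_eq : ∀ a : A, ‖a‖ = sInf {r : ℝ | -(r • ordUnit) ≤ a ∧ a ≤ r • ordUnit}

namespace OrderUnitSpace

section Single

variable (A : Type*) [NormedAddCommGroup A] [NormedSpace ℝ A] [PartialOrder A] [OrderUnitSpace A]

theorem smul_ordUnit_mono {r s : ℝ} (h : r ≤ s) :
    r • (ordUnit : A) ≤ s • (ordUnit : A) := by
  have h1 : (0 : A) ≤ (s - r) • (ordUnit : A) :=
    smul_nonneg (sub_nonneg.2 h) ordUnit_pos.le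
  rw [sub_smul] at h1
  exact sub_nonneg.1 h1

variable {A}

theorem norm_lt_imp {a : A} {r : ℝ} (h : ‖a‖ < r) :
    -(r • (ordUnit : A)) ≤ a ∧ a ≤ r • (ordUnit : A) := by
  have hne : {r : ℝ | -(r • (ordUnit : A)) ≤ a ∧ a ≤ r • (ordUnit : A)}.Nonempty := by
    obtain ⟨r1, h1⟩ := exists_le_smul a
    obtain ⟨r2, h2⟩ := exists_le_smul (-a)
    refine ⟨max r1 r2, ?_, h1.trans (smul_ordUnit_mono A (le_max_left _ _))⟩
    exact neg_le.1 (h2.trans (smul_ordUnit_mono A (le_max_right _ _)))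
  rw [norm_eq] at h
  obtain ⟨s, ⟨hs1, hs2⟩, hs⟩ := exists_lt_of_csInf_lt hne h
  have hsr := smul_ordUnit_mono A hs.le
  exact ⟨(neg_le_neg hsr).trans hs1, hs2.trans hsr⟩

theorem nonneg_of_mem {a : A} {r : ℝ}
    (h : -(r • (ordUnit : A)) ≤ a ∧ a ≤ r • (ordUnit : A)) : 0 ≤ r := by
  by_contra hr
  push Not at hr
  have h1 : (0 : A) ≤ (-r) • (ordUnit : A) := smul_nonneg (neg_pos.2 hr).le ordUnit_pos.le
  rw [neg_smul] at h1
  have h2 : r • (ordUnit : A) = 0 :=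
    le_antisymm (neg_nonneg.1 h1) (h1.trans (h.1.trans h.2))
  exact (smul_ne_zero hr.ne ordUnit_pos.ne') h2

theorem norm_le_of_mem {a : A} {r : ℝ}
    (h : -(r • (ordUnit : A)) ≤ a ∧ a ≤ r • (ordUnit : A)) : ‖a‖ ≤ r := by
  rw [norm_eq]
  exact csInf_le ⟨0, fun s hs => nonneg_of_mem hs⟩ h

end Single

/-- The direct sum of two order-unit spaces, with the componentwise order and the order unit
`(e_A, e_B)`. -/
instance instProd (A B : Type*)
    [NormedAddCommGroup A] [NormedSpace ℝ A] [PartialOrder A] [OrderUnitSpace A]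
    [NormedAddCommGroup B] [NormedSpace ℝ B] [PartialOrder B] [OrderUnitSpace B] :
    OrderUnitSpace (A × B) where
  ordUnit := (ordUnit, ordUnit)
  ordUnit_pos := by
    refine lt_of_le_of_ne ⟨ordUnit_pos.le, ordUnit_pos.le⟩ fun h => ?_
    exact (ordUnit_pos (A := A)).ne (congrArg Prod.fst h)
  exists_le_smul := by
    rintro ⟨a, b⟩
    obtain ⟨r, hr⟩ := exists_le_smul a
    obtain ⟨s, hs⟩ := exists_le_smul b
    exact ⟨max r s, hr.trans (smul_ordUnit_mono A (le_max_left _ _)),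
      hs.trans (smul_ordUnit_mono B (le_max_right _ _))⟩
  archimedean := by
    rintro ⟨a, b⟩ h
    exact ⟨archimedean a fun r hr => (h r hr).1, archimedean b fun r hr => (h r hr).2⟩
  norm_eq := by
    rintro ⟨a, b⟩
    symm
    apply csInf_eq_of_forall_ge_of_forall_gt_exists_lt
    · refine ⟨‖(a, b)‖ + 1, ?_⟩
      have ha := norm_lt_imp (lt_of_le_of_lt (norm_fst_le (a, b)) (lt_add_one _))
      have hb := norm_lt_imp (lt_of_le_of_lt (norm_snd_le (a, b)) (lt_add_one _))
      exact ⟨⟨ha.1, hb.1⟩, ⟨ha.2, hb.2⟩⟩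
    · rintro r ⟨⟨h1, h2⟩, ⟨h3, h4⟩⟩
      exact max_le (norm_le_of_mem ⟨h1, h3⟩) (norm_le_of_mem ⟨h2, h4⟩)
    · intro w hw
      obtain ⟨r, hr, hrw⟩ := exists_between hw
      have ha := norm_lt_imp (lt_of_le_of_lt (norm_fst_le (a, b)) hr)
      have hb := norm_lt_imp (lt_of_le_of_lt (norm_snd_le (a, b)) hr)
      exact ⟨r, ⟨⟨ha.1, hb.1⟩, ⟨ha.2, hb.2⟩⟩, hrw⟩

section States

variable (A : Type*) [NormedAddCommGroup A] [NormedSpace ℝ A] [PartialOrder A] [OrderUnitSpace A]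

/-- The state space `S(A)`: the bounded linear functionals `μ` with `μ(e) = 1 = ‖μ‖`. As a subset
of the weak dual, it carries the weak-* topology. -/
def stateSpace : Set (WeakDual ℝ A) :=
  {μ | μ ordUnit = 1 ∧ ‖WeakDual.toStrongDual μ‖ = 1}

variable {A}

/-- The metric `ρ_L(μ, ν) = sup {|μ(a) - ν(a)| : L(a) ≤ 1}` on `S(A)`, with values in `[0, ∞]`.
The uniformity and the topology of this structure are those defined by `ρ_L`. -/
noncomputable abbrev lipEMetric (L : Seminorm ℝ A) : PseudoEMetricSpace (stateSpace A) where
  edist μ ν := ⨆ a : {a : A // L a ≤ 1},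
    ENNReal.ofReal |(μ : WeakDual ℝ A) a.1 - (ν : WeakDual ℝ A) a.1|
  edist_self μ := by simp
  edist_comm μ ν := by simp only [abs_sub_comm]
  edist_triangle μ ν ξ := by
    refine iSup_le fun a => ?_
    refine le_trans ?_ (add_le_add (le_iSup _ a) (le_iSup _ a))
    rw [← ENNReal.ofReal_add (abs_nonneg _) (abs_nonneg _)]
    exact ENNReal.ofReal_le_ofReal (abs_sub_le _ _ _)

/-- `L` is a Lip-norm: `L(a) = 0` exactly for `a ∈ ℝe`, and the topology of `ρ_L` on `S(A)` is the
weak-* topology. -/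
structure IsLipNorm (L : Seminorm ℝ A) : Prop where
  eq_zero_iff : ∀ a : A, L a = 0 ↔ ∃ r : ℝ, a = r • ordUnit
  topology_eq : (lipEMetric L).toUniformSpace.toTopologicalSpace =
    (inferInstance : TopologicalSpace (stateSpace A))

/-- `L` induces `LB` along `π`: `LB` is the quotient seminorm `LB(b) = inf {L(a) : π(a) = b}`. -/
def Induces {C B : Type*} [AddCommGroup C] [Module ℝ C] [AddCommGroup B] [Module ℝ B]
    (L : Seminorm ℝ C) (π : C →ₗ[ℝ] B) (LB : Seminorm ℝ B) : Prop :=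
  ∀ b : B, IsGLB {t : ℝ | ∃ a : C, π a = b ∧ t = L a} (LB b)

/-- The copy of `S(B)` in `S(C)` given by a morphism `π : C → B`, namely `{ν ∘ π : ν ∈ S(B)}`. -/
def stateImage {C B : Type*}
    [NormedAddCommGroup C] [NormedSpace ℝ C] [PartialOrder C] [OrderUnitSpace C]
    [NormedAddCommGroup B] [NormedSpace ℝ B] [PartialOrder B] [OrderUnitSpace B]
    (π : C →ₗ[ℝ] B) : Set (stateSpace C) :=
  {μ | ∃ ν : stateSpace B, ∀ c : C, (μ : WeakDual ℝ C) c = (ν : WeakDual ℝ B) (π c)}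

end States

end OrderUnitSpace

open OrderUnitSpace

/-- A compact quantum metric space: an order-unit space with a Lip-norm. -/
structure CompactQuantumMetricSpace : Type (u + 1) where
  carrier : Type u
  [normedAddCommGroup : NormedAddCommGroup carrier]
  [normedSpace : NormedSpace ℝ carrier]
  [partialOrder : PartialOrder carrier]
  [orderUnitSpace : OrderUnitSpace carrier]
  lip : Seminorm ℝ carrier
  isLipNorm : IsLipNorm lip

namespace CompactQuantumMetricSpace

attribute [instance] normedAddCommGroup normedSpace partialOrder orderUnitSpace

/-- `𝓜(L_A, L_B)`: the Lip-norms on `A ⊕ B` which induce `L_A` and `L_B` along the two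
projections. -/
def inducingLipNorms (A B : CompactQuantumMetricSpace.{u}) :
    Set (Seminorm ℝ (A.carrier × B.carrier)) :=
  {L | IsLipNorm L ∧ Induces L (LinearMap.fst ℝ A.carrier B.carrier) A.lip ∧
    Induces L (LinearMap.snd ℝ A.carrier B.carrier) B.lip}

/-- The quantum Gromov–Hausdorff distance: the infimum over `L ∈ 𝓜(L_A, L_B)` of the Hausdorff
distance for `ρ_L` between `S(A)` and `S(B)` inside `S(A ⊕ B)`. -/
noncomputable def distq (A B : CompactQuantumMetricSpace.{u}) : ℝ≥0∞ :=
  ⨅ L ∈ inducingLipNorms A B,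
    @Metric.hausdorffEDist _ (lipEMetric L)
      (stateImage (LinearMap.fst ℝ A.carrier B.carrier))
      (stateImage (LinearMap.snd ℝ A.carrier B.carrier))

/-- The norm completion `Ā` of the order-unit space `A`. -/
abbrev Compl (A : CompactQuantumMetricSpace.{u}) : Type u := UniformSpace.Completion A.carrier

/-- The positive cone of `Ā`: the closure of the positive cone of `A`. -/
def complPos (A : CompactQuantumMetricSpace.{u}) : Set A.Compl :=
  closure ((fun a : A.carrier => (a : A.Compl)) '' {a | 0 ≤ a})

/-- The closed unit ball of the closure `L^c` of `L`: the closure in `Ā` of `{a : L(a) ≤ 1}`. -/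
def closedLipBall (A : CompactQuantumMetricSpace.{u}) : Set A.Compl :=
  closure ((fun a : A.carrier => (a : A.Compl)) '' {a | A.lip a ≤ 1})

/-- The domain `A^c ⊆ Ā` of the closure `(A^c, L^c)` of `(A, L)`. -/
noncomputable def closureDomain (A : CompactQuantumMetricSpace.{u}) : Submodule ℝ A.Compl :=
  Submodule.span ℝ A.closedLipBall

/-- The Lip-norm `L^c` on `A^c`: the seminorm (Minkowski functional) of its closed unit ball. -/
noncomputable def closureLip (A : CompactQuantumMetricSpace.{u}) (x : A.closureDomain) : ℝ :=
  gauge A.closedLipBall (x : A.Compl)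

/-- The order unit of `A`, as an element of `A^c`. -/
noncomputable def closureUnit (A : CompactQuantumMetricSpace.{u}) : A.closureDomain :=
  ⟨((ordUnit : A.carrier) : A.Compl), Submodule.subset_span (subset_closure
    ⟨ordUnit, by
      have h : A.lip ordUnit = 0 :=
        (A.isLipNorm.eq_zero_iff _).2 ⟨1, (one_smul ℝ _).symm⟩
      simp [h], rfl⟩)⟩

/-- An isometry from `A` to `B`: an isomorphism `φ` of order-unit spaces from `A^c` onto `B^c`
with `L_A^c = L_B^c ∘ φ`. -/
structure Isometry (A B : CompactQuantumMetricSpace.{u}) where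
  toEquiv : A.closureDomain ≃ₗ[ℝ] B.closureDomain
  map_unit : toEquiv A.closureUnit = B.closureUnit
  map_pos : ∀ x : A.closureDomain,
    (toEquiv x : B.Compl) ∈ B.complPos ↔ (x : A.Compl) ∈ A.complPos
  map_lip : ∀ x : A.closureDomain, A.closureLip x = B.closureLip (toEquiv x)

instance isometrySetoid : Setoid CompactQuantumMetricSpace.{u} where
  r A B := Nonempty (Isometry A B)
  iseqv :=
    { refl := fun A => ⟨⟨LinearEquiv.refl ℝ _, rfl, fun _ => Iff.rfl, fun _ => rfl⟩⟩
      symm := by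
        rintro A B ⟨f⟩
        refine ⟨⟨f.toEquiv.symm, ?_, fun x => ?_, fun x => ?_⟩⟩
        · rw [LinearEquiv.symm_apply_eq, f.map_unit]
        · simpa using (f.map_pos (f.toEquiv.symm x)).symm
        · simpa using (f.map_lip (f.toEquiv.symm x)).symm
      trans := by
        rintro A B C ⟨f⟩ ⟨g⟩
        refine ⟨⟨f.toEquiv.trans g.toEquiv, ?_, fun x => ?_, fun x => ?_⟩⟩
        · simp [f.map_unit, g.map_unit]
        · simpa using (g.map_pos (f.toEquiv x)).trans (f.map_pos x)
        · simpa using (f.map_lip x).trans (g.map_lip (f.toEquiv x)) }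

/-- The set `𝓠` of isometry equivalence classes of compact quantum metric spaces. -/
def IsometryClass : Type (u + 1) := Quotient isometrySetoid.{u}

/-- The isometry class of a compact quantum metric space. -/
def toClass (A : CompactQuantumMetricSpace.{u}) : IsometryClass.{u} :=
  Quotient.mk isometrySetoid A

end CompactQuantumMetricSpace

open Topology Pointwise

namespace OrderUnitSpace

/-! ### The order-unit norm and its one-sided version `ordSup` -/

section Norm

variable {A : Type*} [NormedAddCommGroup A] [NormedSpace ℝ A] [PartialOrder A] [OrderUnitSpace A]

theorem le_norm_smul (a : A) : a ≤ ‖a‖ • (ordUnit : A) := by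
  rw [← sub_nonpos]
  refine archimedean _ fun r hr => ?_
  have h := (norm_lt_imp (lt_add_of_pos_right ‖a‖ hr)).2
  rw [add_smul] at h
  exact sub_le_iff_le_add'.2 h

theorem neg_norm_smul_le (a : A) : -(‖a‖ • (ordUnit : A)) ≤ a := by
  have h := le_norm_smul (-a)
  rw [norm_neg] at h
  exact neg_le.1 h

theorem norm_le_iff {a : A} {r : ℝ} :
    ‖a‖ ≤ r ↔ -(r • (ordUnit : A)) ≤ a ∧ a ≤ r • (ordUnit : A) := by
  refine ⟨fun h => ?_, norm_le_of_mem⟩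
  have h' := smul_ordUnit_mono A h
  exact ⟨(neg_le_neg h').trans (neg_norm_smul_le a), (le_norm_smul a).trans h'⟩

theorem smul_ordUnit_le_iff {r s : ℝ} : r • (ordUnit : A) ≤ s • (ordUnit : A) ↔ r ≤ s := by
  refine ⟨fun h => ?_, smul_ordUnit_mono A⟩
  have h0 : (0 : A) ≤ (s - r) • (ordUnit : A) := by
    rw [sub_smul]; exact sub_nonneg.2 h
  have := nonneg_of_mem (a := (0 : A)) (r := s - r) ⟨neg_nonpos.2 h0, h0⟩
  linarith

theorem norm_ordUnit : ‖(ordUnit : A)‖ = 1 := by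
  apply le_antisymm
  · rw [norm_le_iff, one_smul]
    exact ⟨(neg_nonpos.2 ordUnit_pos.le).trans ordUnit_pos.le, le_rfl⟩
  · have h := le_norm_smul (ordUnit : A)
    nth_rw 1 [← one_smul ℝ (ordUnit : A)] at h
    exact smul_ordUnit_le_iff.1 h

/-- The least `r` with `a ≤ r e`, that is, the maximum of `a` on the state space. -/
noncomputable def ordSup (a : A) : ℝ := sInf {r : ℝ | a ≤ r • (ordUnit : A)}

theorem neg_norm_le_of_le {a : A} {r : ℝ} (h : a ≤ r • (ordUnit : A)) : -‖a‖ ≤ r := by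
  rw [← smul_ordUnit_le_iff (A := A), neg_smul]
  exact (neg_norm_smul_le a).trans h

theorem bddBelow_ordSup (a : A) : BddBelow {r : ℝ | a ≤ r • (ordUnit : A)} :=
  ⟨-‖a‖, fun _ hr => neg_norm_le_of_le hr⟩

theorem le_ordSup_smul (a : A) : a ≤ ordSup a • (ordUnit : A) := by
  rw [← sub_nonpos]
  refine archimedean _ fun r hr => ?_
  obtain ⟨s, hs, hsr⟩ := exists_lt_of_csInf_lt ⟨‖a‖, le_norm_smul a⟩
    (lt_add_of_pos_right (ordSup a) hr)
  have h := le_trans hs (smul_ordUnit_mono A hsr.le)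
  rw [add_smul] at h
  exact sub_le_iff_le_add'.2 h

theorem ordSup_le_iff {a : A} {r : ℝ} : ordSup a ≤ r ↔ a ≤ r • (ordUnit : A) :=
  ⟨fun h => (le_ordSup_smul a).trans (smul_ordUnit_mono A h), fun h => csInf_le (bddBelow_ordSup a) h⟩

theorem ordSup_le_norm (a : A) : ordSup a ≤ ‖a‖ := ordSup_le_iff.2 (le_norm_smul a)

theorem norm_le_iff_ordSup {a : A} {r : ℝ} : ‖a‖ ≤ r ↔ ordSup a ≤ r ∧ ordSup (-a) ≤ r := by
  rw [norm_le_iff, ordSup_le_iff, ordSup_le_iff, neg_le, and_comm]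

theorem norm_eq_max_ordSup (a : A) : ‖a‖ = max (ordSup a) (ordSup (-a)) :=
  eq_of_forall_ge_iff fun r => by rw [norm_le_iff_ordSup, max_le_iff]

theorem ordSup_add_smul_ordUnit (a : A) (c : ℝ) :
    ordSup (a + c • (ordUnit : A)) = ordSup a + c :=
  eq_of_forall_ge_iff fun r => by
    rw [ordSup_le_iff, ← le_sub_iff_add_le, ← le_sub_iff_add_le, ordSup_le_iff, sub_smul]

theorem ordSup_add_le (a b : A) : ordSup (a + b) ≤ ordSup a + ordSup b := by
  rw [ordSup_le_iff, add_smul]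
  exact add_le_add (le_ordSup_smul a) (le_ordSup_smul b)

theorem ordSup_smul_le (a : A) {t : ℝ} (ht : 0 ≤ t) : ordSup (t • a) ≤ t * ordSup a := by
  rw [ordSup_le_iff, mul_smul]
  exact smul_le_smul_of_nonneg_left (le_ordSup_smul a) ht

theorem ordSup_smul (a : A) {t : ℝ} (ht : 0 < t) : ordSup (t • a) = t * ordSup a := by
  refine le_antisymm (ordSup_smul_le a ht.le) ?_
  have h := ordSup_smul_le (t • a) (inv_nonneg.2 ht.le)
  rw [inv_smul_smul₀ ht.ne'] at h
  rwa [inv_mul_eq_div, le_div_iff₀' ht] at h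

theorem abs_ordSup_sub_le (a b : A) : |ordSup a - ordSup b| ≤ ‖a - b‖ := by
  have key : ∀ a b : A, ordSup a - ordSup b ≤ ‖a - b‖ := fun a b => by
    have h := ordSup_add_le (a - b) b
    rw [sub_add_cancel] at h
    linarith [ordSup_le_norm (a - b)]
  rw [abs_le]
  have := key b a
  rw [norm_sub_rev] at this
  exact ⟨by linarith, key a b⟩

/-- The norm and the unit determine the order; this is why norm-preserving unital maps are order
isomorphisms. -/
theorem nonneg_iff_norm {a : A} {r : ℝ} (hr : ‖a‖ ≤ r) :
    0 ≤ a ↔ ‖r • (ordUnit : A) - a‖ ≤ r := by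
  rw [norm_le_iff, sub_le_self_iff, neg_le_sub_iff_le_add']
  refine ⟨fun h => ⟨?_, h⟩, fun h => h.2⟩
  have h1 := (norm_le_iff.1 hr).2
  have h2 : (0 : A) ≤ r • (ordUnit : A) := smul_nonneg ((norm_nonneg a).trans hr) ordUnit_pos.le
  exact h1.trans (le_add_of_nonneg_left h2)

end Norm

/-! ### States: norm attainment, compactness, segments -/

section States

variable {A : Type*} [NormedAddCommGroup A] [NormedSpace ℝ A] [PartialOrder A] [OrderUnitSpace A]

theorem state_ordUnit (μ : stateSpace A) : (μ : WeakDual ℝ A) ordUnit = 1 := μ.2.1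

theorem abs_state_le (μ : stateSpace A) (a : A) : |(μ : WeakDual ℝ A) a| ≤ ‖a‖ := by
  have h := (WeakDual.toStrongDual (μ : WeakDual ℝ A)).le_opNorm a
  rw [μ.2.2, one_mul] at h
  exact h

theorem mem_stateSpace_of_le {μ : WeakDual ℝ A} (h1 : μ ordUnit = 1) (h : ∀ a, |μ a| ≤ ‖a‖) :
    μ ∈ stateSpace A := by
  refine ⟨h1, le_antisymm ?_ ?_⟩
  · refine ContinuousLinearMap.opNorm_le_bound _ zero_le_one fun a => ?_
    rw [one_mul]
    exact h a
  · have h2 := (WeakDual.toStrongDual μ).le_opNorm (ordUnit : A)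
    rw [norm_ordUnit, mul_one] at h2
    have h3 : WeakDual.toStrongDual μ (ordUnit : A) = 1 := h1
    rwa [h3, norm_one] at h2

theorem exists_state_eq (f : A →ₗ[ℝ] ℝ) (h1 : f ordUnit = 1) (h : ∀ a, f a ≤ ‖a‖) :
    ∃ μ : stateSpace A, ∀ a, (μ : WeakDual ℝ A) a = f a := by
  have h' : ∀ a, |f a| ≤ ‖a‖ := fun a => abs_le.2 ⟨by
    have := h (-a); rw [map_neg, norm_neg] at this; linarith, h a⟩
  let g : StrongDual ℝ A := f.mkContinuous 1 fun a => by rw [one_mul]; exact h' a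
  exact ⟨⟨StrongDual.toWeakDual g, mem_stateSpace_of_le h1 h'⟩, fun a => rfl⟩

/-- Take a norming functional `g` at `a + ‖a‖ e`, whose norm is at least `2‖a‖`. As `g a ≤ ‖a‖` and
`g e ≤ 1`, both must be equalities, so `g` is a state. -/
theorem exists_state_eq_norm_of_ordSup {a : A} (ha : a ≠ 0) (h : ordSup a = ‖a‖) :
    ∃ μ : stateSpace A, (μ : WeakDual ℝ A) a = ‖a‖ := by
  have hpos : 0 < ‖a‖ := norm_pos_iff.2 ha
  have h2 : 2 * ‖a‖ ≤ ‖a + ‖a‖ • (ordUnit : A)‖ := by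
    refine le_trans (le_of_eq ?_) (ordSup_le_norm _)
    rw [ordSup_add_smul_ordUnit, h, two_mul]
  have hne : a + ‖a‖ • (ordUnit : A) ≠ 0 := by
    rw [← norm_pos_iff]; linarith
  obtain ⟨g, hg, hga⟩ := exists_dual_vector ℝ _ (norm_ne_zero_iff.2 hne)
  have hb : ∀ b, g b ≤ ‖b‖ := fun b =>
    (le_abs_self _).trans (by simpa [hg] using g.le_opNorm b)
  have hge : g ordUnit ≤ 1 := by simpa [norm_ordUnit] using hb ordUnit
  have hgs : g (a + ‖a‖ • (ordUnit : A)) = g a + ‖a‖ * g ordUnit := by simp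
  have hga' : 2 * ‖a‖ ≤ g a + ‖a‖ * g ordUnit := by
    rw [← hgs, hga]; exact_mod_cast h2
  have h3 : ‖a‖ * g ordUnit ≤ ‖a‖ := mul_le_of_le_one_right hpos.le hge
  have h4 := hb a
  have h5 : g ordUnit = 1 := by
    refine le_antisymm hge (le_of_mul_le_mul_left ?_ hpos)
    linarith
  obtain ⟨μ, hμ⟩ := exists_state_eq (g : A →ₗ[ℝ] ℝ) h5 hb
  exact ⟨μ, (hμ a).trans (by simp; linarith)⟩

/-- One of `ordSup a`, `ordSup (-a)` is the norm. For `a = 0` any state will do, and one exists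
because `e ≠ 0`. -/
theorem exists_state_abs_eq_norm (a : A) : ∃ μ : stateSpace A, |(μ : WeakDual ℝ A) a| = ‖a‖ := by
  have main : ∀ a : A, a ≠ 0 → ∃ μ : stateSpace A, |(μ : WeakDual ℝ A) a| = ‖a‖ := by
    intro a ha
    rcases max_choice (ordSup a) (ordSup (-a)) with h | h
    · obtain ⟨μ, hμ⟩ := exists_state_eq_norm_of_ordSup ha ((norm_eq_max_ordSup a).trans h).symm
      exact ⟨μ, by rw [hμ, abs_norm]⟩
    · obtain ⟨μ, hμ⟩ := exists_state_eq_norm_of_ordSup (neg_ne_zero.2 ha)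
        (by rw [norm_neg]; exact ((norm_eq_max_ordSup a).trans h).symm)
      exact ⟨μ, by rw [← abs_neg, ← map_neg, hμ, norm_neg, abs_norm]⟩
  by_cases ha : a = 0
  · obtain ⟨μ, -⟩ := main (ordUnit : A) ordUnit_pos.ne'
    exact ⟨μ, by simp [ha]⟩
  · exact main a ha

theorem nonempty_stateSpace : Nonempty (stateSpace A) :=
  let ⟨μ, _⟩ := exists_state_abs_eq_norm (0 : A)
  ⟨μ⟩

theorem norm_le_of_forall_state {a : A} {r : ℝ}
    (h : ∀ μ : stateSpace A, |(μ : WeakDual ℝ A) a| ≤ r) : ‖a‖ ≤ r :=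
  let ⟨μ, hμ⟩ := exists_state_abs_eq_norm a
  hμ ▸ h μ

theorem isCompact_stateSpace : IsCompact (stateSpace A) := by
  have hs : stateSpace A = (WeakDual.toStrongDual ⁻¹' Metric.closedBall (0 : StrongDual ℝ A) 1) ∩
      {μ | μ ordUnit = 1} := by
    ext μ
    constructor
    · rintro ⟨h1, h2⟩
      exact ⟨by simp [h2], h1⟩
    · rintro ⟨h1, h2⟩
      refine mem_stateSpace_of_le h2 fun a => ?_
      have h := (WeakDual.toStrongDual μ).le_of_opNorm_le (mem_closedBall_zero_iff.1 h1) a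
      rwa [one_mul] at h
  rw [hs]
  exact (WeakDual.isCompact_closedBall 0 1).inter_right
    (isClosed_eq (WeakDual.eval_continuous _) continuous_const)

/-- The point `(1 - t) μ + t ν` of the segment between two states. -/
noncomputable def stateSegment (μ ν : stateSpace A) (t : Set.Icc (0 : ℝ) 1) : stateSpace A :=
  ⟨(1 - (t : ℝ)) • (μ : WeakDual ℝ A) + (t : ℝ) • (ν : WeakDual ℝ A), by
    refine mem_stateSpace_of_le ?_ fun a => ?_
    · change (1 - (t : ℝ)) * (μ : WeakDual ℝ A) ordUnit + t * (ν : WeakDual ℝ A) ordUnit = 1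
      rw [state_ordUnit, state_ordUnit]; ring
    · change |(1 - (t : ℝ)) * (μ : WeakDual ℝ A) a + t * (ν : WeakDual ℝ A) a| ≤ ‖a‖
      have h1 := abs_le.1 (abs_state_le μ a)
      have h2 := abs_le.1 (abs_state_le ν a)
      obtain ⟨t, ht0, ht1⟩ := t
      rw [abs_le]
      constructor <;> nlinarith⟩

theorem stateSegment_apply (μ ν : stateSpace A) (t : Set.Icc (0 : ℝ) 1) (a : A) :
    (stateSegment μ ν t : WeakDual ℝ A) a =
      (1 - (t : ℝ)) * (μ : WeakDual ℝ A) a + t * (ν : WeakDual ℝ A) a := rfl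

theorem continuous_stateSegment (μ ν : stateSpace A) : Continuous (stateSegment μ ν) := by
  refine Continuous.subtype_mk ?_ _
  fun_prop

end States

end OrderUnitSpace

/-! ### Lip-norms and total boundedness of the Lip-ball modulo constants -/

namespace OrderUnitSpace

theorem abs_le_mul_seminorm {E : Type*} [AddCommGroup E] [Module ℝ E] (q : Seminorm ℝ E)
    (f : E →ₗ[ℝ] ℝ) {r : ℝ} (h : ∀ a, q a ≤ 1 → |f a| ≤ r) (a : E) : |f a| ≤ r * q a := by
  have hr : 0 ≤ r := (abs_nonneg _).trans (h 0 (by simp))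
  have key : ∀ s : ℝ, 0 < s → q a ≤ s → |f a| ≤ r * s := fun s hs hqs => by
    have h1 := h (s⁻¹ • a) (by
      rw [map_smul_eq_mul, Real.norm_eq_abs, abs_of_pos (inv_pos.2 hs), inv_mul_le_iff₀ hs]
      simpa using hqs)
    rw [map_smul, smul_eq_mul, abs_mul, abs_of_pos (inv_pos.2 hs), inv_mul_le_iff₀ hs] at h1
    linarith
  rcases (apply_nonneg q a).eq_or_lt with h0 | h0
  · refine le_of_forall_pos_le_add fun ε hε => ?_
    -- If `q a = 0`, the bound holds at every positive scale; this scale makes it at most `ε`, and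
    -- the `+ 1` allows `r = 0`.
    have h1 := key (ε / (r + 1)) (by positivity) (by rw [← h0]; positivity)
    rw [← h0, mul_zero, zero_add]
    refine h1.trans ?_
    rw [mul_div_assoc', div_le_iff₀ (by positivity)]
    nlinarith
  · exact key _ h0 le_rfl

section Single

variable {A : Type*} [NormedAddCommGroup A] [NormedSpace ℝ A] [PartialOrder A] [OrderUnitSpace A]

theorem lipEMetric_le_iff {L : Seminorm ℝ A} {μ ν : stateSpace A} {r : ℝ} (hr : 0 ≤ r) :
    (lipEMetric L).edist μ ν ≤ ENNReal.ofReal r ↔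
      ∀ a, L a ≤ 1 → |(μ : WeakDual ℝ A) a - (ν : WeakDual ℝ A) a| ≤ r := by
  change (⨆ a : {a : A // L a ≤ 1}, ENNReal.ofReal _) ≤ _ ↔ _
  simp only [iSup_le_iff, Subtype.forall, ENNReal.ofReal_le_ofReal_iff hr]

theorem lipEMetric_nhds_basis (L : Seminorm ℝ A) (μ : stateSpace A) {s : Set (stateSpace A)} :
    s ∈ @nhds _ (lipEMetric L).toUniformSpace.toTopologicalSpace μ ↔
      ∃ δ : ℝ, 0 < δ ∧ ∀ ν : stateSpace A,
        (∀ a, L a ≤ 1 → |(ν : WeakDual ℝ A) a - (μ : WeakDual ℝ A) a| ≤ δ) → ν ∈ s := by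
  rw [(@Metric.nhds_basis_closedEBall _ (lipEMetric L) μ).mem_iff]
  constructor
  · rintro ⟨ε, hε, h⟩
    obtain ⟨δ, hδ, hδε⟩ := ENNReal.lt_iff_exists_nnreal_btwn.1 hε
    refine ⟨δ, by exact_mod_cast hδ, fun ν hν => h ?_⟩
    exact ((lipEMetric_le_iff δ.2).2 hν).trans (ENNReal.ofReal_coe_nnreal.trans_le hδε.le)
  · rintro ⟨δ, hδ, h⟩
    refine ⟨ENNReal.ofReal δ, ENNReal.ofReal_pos.2 hδ, fun ν hν => h ν ?_⟩
    exact (lipEMetric_le_iff hδ.le).1 hν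

theorem IsLipNorm.mem_nhds {L : Seminorm ℝ A} (hL : IsLipNorm L) (μ : stateSpace A) {δ : ℝ}
    (hδ : 0 < δ) :
    {ν : stateSpace A | ∀ a, L a ≤ 1 → |(ν : WeakDual ℝ A) a - (μ : WeakDual ℝ A) a| ≤ δ} ∈
      𝓝 μ := by
  have h := (lipEMetric_nhds_basis L μ).2 ⟨δ, hδ, fun ν hν => hν⟩
  rwa [hL.topology_eq] at h

/-- The segment from `μ` to `ν` is weak-* continuous, so its point at some `t > 0` lies in the
`ρ_L`-ball of radius 1 about `μ`. Differences of states scale by `t` along the segment, which gives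
the bound `1 / t`. -/
theorem IsLipNorm.exists_forall_abs_sub_le_pair {L : Seminorm ℝ A} (hL : IsLipNorm L)
    (μ ν : stateSpace A) :
    ∃ r : ℝ, ∀ a, L a ≤ 1 → |(ν : WeakDual ℝ A) a - (μ : WeakDual ℝ A) a| ≤ r := by
  have h0 : stateSegment μ ν ⟨0, by simp⟩ = μ := by
    apply Subtype.ext
    simp [stateSegment]
  have h1 := (continuous_stateSegment μ ν).continuousAt.preimage_mem_nhds
    (h0.symm ▸ hL.mem_nhds μ one_pos)
  obtain ⟨ε, hε, hball⟩ := Metric.mem_nhds_iff.1 h1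
  have ht : 0 < min (ε / 2) 1 := by positivity
  have h2 := @hball ⟨min (ε / 2) 1, ht.le, min_le_right _ _⟩ (by
    rw [Metric.mem_ball, Subtype.dist_eq, Real.dist_eq, sub_zero, abs_of_pos ht]
    exact (min_le_left _ _).trans_lt (by linarith))
  refine ⟨1 / min (ε / 2) 1, fun a ha => ?_⟩
  have h3 := h2 a ha
  rw [stateSegment_apply, h0] at h3
  rw [le_div_iff₀ ht]
  refine le_trans (le_of_eq ?_) h3
  conv_lhs => rw [← abs_of_pos ht, ← abs_mul]
  congr 1
  ring

theorem IsLipNorm.exists_finite_net {L : Seminorm ℝ A} (hL : IsLipNorm L) {δ : ℝ} (hδ : 0 < δ) :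
    ∃ F : Finset (stateSpace A), ∀ μ : stateSpace A, ∃ ν ∈ F, ∀ a, L a ≤ 1 →
      |(μ : WeakDual ℝ A) a - (ν : WeakDual ℝ A) a| ≤ δ := by
  have : CompactSpace (stateSpace A) := isCompact_iff_compactSpace.1 isCompact_stateSpace
  obtain ⟨F, -, hF⟩ := (isCompact_univ (X := stateSpace A)).elim_nhds_subcover _
    fun μ _ => hL.mem_nhds μ hδ
  refine ⟨F, fun μ => ?_⟩
  obtain ⟨ν, hν, h⟩ := Set.mem_iUnion₂.1 (hF (Set.mem_univ μ))
  exact ⟨ν, hν, h⟩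

/-- The state space has finite diameter. -/
theorem IsLipNorm.exists_forall_abs_sub_le {L : Seminorm ℝ A} (hL : IsLipNorm L)
    (μ₀ : stateSpace A) :
    ∃ r : ℝ, ∀ μ : stateSpace A, ∀ a, L a ≤ 1 →
      |(μ : WeakDual ℝ A) a - (μ₀ : WeakDual ℝ A) a| ≤ r := by
  obtain ⟨F, hF⟩ := hL.exists_finite_net one_pos
  choose r hr using fun ν => hL.exists_forall_abs_sub_le_pair μ₀ ν
  obtain ⟨M, hM⟩ := (F.image r).bddAbove
  refine ⟨1 + M, fun μ a ha => ?_⟩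
  obtain ⟨ν, hν, hμν⟩ := hF μ
  refine (abs_sub_le _ ((ν : WeakDual ℝ A) a) _).trans (add_le_add (hμν a ha) ?_)
  exact (hr ν a ha).trans (hM (Finset.mem_coe.2 (Finset.mem_image_of_mem r hν)))

/-- Evaluation at a finite `ρ_L`-net of states maps the normalised ball into a bounded subset of
`ℝ^F`. Elements of the ball with close values on the net have close values at every state, hence are
close in norm. -/
theorem IsLipNorm.totallyBounded {L : Seminorm ℝ A} (hL : IsLipNorm L) (μ₀ : stateSpace A) :
    TotallyBounded {a : A | L a ≤ 1 ∧ (μ₀ : WeakDual ℝ A) a = 0} := by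
  obtain ⟨R, hR⟩ := hL.exists_forall_abs_sub_le μ₀
  rw [Metric.totallyBounded_iff]
  intro ε hε
  have hδ : 0 < ε / 4 := by positivity
  obtain ⟨F, hF⟩ := hL.exists_finite_net hδ
  let Φ : A → F → ℝ := fun a ν => ((ν : stateSpace A) : WeakDual ℝ A) a
  set T := {a : A | L a ≤ 1 ∧ (μ₀ : WeakDual ℝ A) a = 0}
  have hT : TotallyBounded (Φ '' T) := by
    refine (isCompact_closedBall (0 : F → ℝ) R).totallyBounded.subset ?_
    rintro _ ⟨a, ha, rfl⟩
    rw [mem_closedBall_zero_iff]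
    have h0 : ∀ μ : stateSpace A, |(μ : WeakDual ℝ A) a| ≤ R := fun μ => by
      simpa [ha.2] using hR μ a ha.1
    exact (pi_norm_le_iff_of_nonneg ((abs_nonneg _).trans (h0 μ₀))).2 fun ν => h0 ν
  obtain ⟨t, hts, htf, hcov⟩ := Metric.finite_approx_of_totallyBounded hT _ hδ
  obtain ⟨t', ht's, ht'f, rfl⟩ := (Set.exists_subset_image_finite_and (f := Φ) (s := T)
    (p := fun s => s = t)).1 ⟨t, hts, htf, rfl⟩
  refine ⟨t', ht'f, fun a ha => ?_⟩
  obtain ⟨_, ⟨b, hb, rfl⟩, hab⟩ := Set.mem_iUnion₂.1 (hcov ⟨a, ha, rfl⟩)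
  refine Set.mem_iUnion₂.2 ⟨b, hb, ?_⟩
  rw [Metric.mem_ball, dist_eq_norm]
  -- One error `ε / 4` for moving from `μ` to `ν` at each of `a` and `b`, and one for comparing `a`
  -- with `b` at `ν`.
  refine lt_of_le_of_lt (norm_le_of_forall_state (r := 3 * (ε / 4)) fun μ => ?_) (by linarith)
  obtain ⟨ν, hν, hμν⟩ := hF μ
  have h1 := abs_le.1 (hμν a ha.1)
  have h2 := abs_le.1 (hμν b (ht's hb).1)
  have h3 : |(ν : WeakDual ℝ A) a - (ν : WeakDual ℝ A) b| < ε / 4 := by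
    have := (dist_pi_lt_iff hδ).1 (Metric.mem_ball.1 hab) ⟨ν, hν⟩
    rwa [Real.dist_eq] at this
  have h4 := abs_lt.1 h3
  rw [map_sub, abs_le]
  constructor <;> linarith

theorem continuous_stateSpace_of_eval {X : Type*} [TopologicalSpace X] {F : X → stateSpace A}
    (h : ∀ a x, ∀ ε > 0, ∀ᶠ y in 𝓝 x,
      |(F y : WeakDual ℝ A) a - (F x : WeakDual ℝ A) a| ≤ ε) : Continuous F := by
  refine continuous_induced_rng.2 (WeakDual.continuous_of_continuous_eval fun a => ?_)
  rw [continuous_iff_continuousAt]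
  exact fun x => Metric.nhds_basis_closedBall.tendsto_right_iff.2 fun ε hε => h a x ε hε

/-- Evaluation at `a` is `L(a)`-Lipschitz for `ρ_L`, so `ρ_L` refines the weak-* topology.
Conversely, states close on a finite net of the normalised ball are uniformly close on the whole
Lip-ball, since differences of states do not see constants. -/
theorem isLipNorm_of_totallyBounded {L : Seminorm ℝ A}
    (h0 : ∀ a : A, L a = 0 ↔ ∃ r : ℝ, a = r • ordUnit) (μ₀ : stateSpace A)
    (hT : TotallyBounded {a : A | L a ≤ 1 ∧ (μ₀ : WeakDual ℝ A) a = 0}) : IsLipNorm L := by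
  refine ⟨h0, le_antisymm ?_ (le_of_nhds_le_nhds fun μ s hs => ?_)⟩
  · refine continuous_id_iff_le.1 (@continuous_stateSpace_of_eval _ _ _ _ _ _
      (lipEMetric L).toUniformSpace.toTopologicalSpace id fun a μ ε hε => ?_)
    rw [Filter.Eventually, lipEMetric_nhds_basis]
    have hpos : 0 < L a + 1 := by positivity
    refine ⟨ε / (L a + 1), by positivity, fun ν hν => ?_⟩
    have h := abs_le_mul_seminorm L
      ((ν : WeakDual ℝ A) - (μ : WeakDual ℝ A) : A →L[ℝ] ℝ).toLinearMap hν a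
    change |(ν : WeakDual ℝ A) a - (μ : WeakDual ℝ A) a| ≤ _ at h
    refine h.trans ?_
    rw [div_mul_eq_mul_div, div_le_iff₀ hpos]
    nlinarith
  · obtain ⟨δ, hδ, hs⟩ := (lipEMetric_nhds_basis L μ).1 hs
    obtain ⟨t, -, htf, hcov⟩ := Metric.finite_approx_of_totallyBounded hT (δ / 4) (by positivity)
    have hU : ∀ᶠ ν : stateSpace A in 𝓝 μ,
        ∀ f ∈ t, |(ν : WeakDual ℝ A) f - (μ : WeakDual ℝ A) f| < δ / 4 := by
      refine htf.eventually_all.2 fun f _ => ?_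
      have hc : Continuous fun ν : stateSpace A => (ν : WeakDual ℝ A) f :=
        (WeakDual.eval_continuous f).comp continuous_subtype_val
      have := Metric.tendsto_nhds.1 (hc.tendsto μ) (δ / 4) (by positivity)
      simpa only [Real.dist_eq] using this
    filter_upwards [hU] with ν hν
    refine hs ν fun a ha => ?_
    set c := (μ₀ : WeakDual ℝ A) a
    have he : L ordUnit = 0 := (h0 _).2 ⟨1, (one_smul ℝ _).symm⟩
    have hmem : a - c • ordUnit ∈ {a : A | L a ≤ 1 ∧ (μ₀ : WeakDual ℝ A) a = 0} := by
      refine ⟨(map_sub_le_add L _ _).trans ?_, ?_⟩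
      · rw [map_smul_eq_mul, he, mul_zero, add_zero]
        exact ha
      · rw [map_sub, map_smul, state_ordUnit, smul_eq_mul, mul_one, sub_self]
    obtain ⟨f, hf, haf⟩ := Set.mem_iUnion₂.1 (hcov hmem)
    rw [Metric.mem_ball, dist_eq_norm] at haf
    have h1 := abs_le.1 ((abs_state_le ν _).trans haf.le)
    have h2 := abs_le.1 ((abs_state_le μ _).trans haf.le)
    have h3 := abs_lt.1 (hν f hf)
    simp only [map_sub, map_smul, state_ordUnit, smul_eq_mul, mul_one] at h1 h2
    rw [abs_le]
    constructor <;> linarith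

end Single

end OrderUnitSpace

/-! ### Quotient seminorms and products -/

/-- The seminorm `x ↦ inf_y q (x, y)`, which is the quotient of `q` along `E × F → E`. -/
noncomputable def Seminorm.infFiber {E F : Type*} [AddCommGroup E] [Module ℝ E] [AddCommGroup F]
    [Module ℝ F] (q : Seminorm ℝ (E × F)) : Seminorm ℝ E :=
  have hb : ∀ x, BddBelow (Set.range fun y => q (x, y)) := fun x =>
    ⟨0, by rintro _ ⟨y, rfl⟩; exact apply_nonneg q _⟩
  Seminorm.ofSMulLE (fun x => ⨅ y, q (x, y))
    (le_antisymm (ciInf_le_of_le (hb 0) 0 (map_zero q).le) (le_ciInf fun _ => apply_nonneg q _))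
    (fun x x' => by
      refine le_ciInf_add_ciInf fun y y' => ?_
      exact (ciInf_le (hb _) (y + y')).trans (map_add_le_add q (x, y) (x', y')))
    (fun t x => by
      rw [Real.mul_iInf_of_nonneg (norm_nonneg t)]
      refine le_ciInf fun y => (ciInf_le (hb _) (t • y)).trans ?_
      rw [← map_smul_eq_mul]
      rfl)

theorem Seminorm.infFiber_apply {E F : Type*} [AddCommGroup E] [Module ℝ E] [AddCommGroup F]
    [Module ℝ F] (q : Seminorm ℝ (E × F)) (x : E) : q.infFiber x = ⨅ y, q (x, y) := rfl

theorem Seminorm.infFiber_le {E F : Type*} [AddCommGroup E] [Module ℝ E] [AddCommGroup F]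
    [Module ℝ F] (q : Seminorm ℝ (E × F)) (x : E) (y : F) : q.infFiber x ≤ q (x, y) :=
  ciInf_le ⟨0, by rintro _ ⟨y, rfl⟩; exact apply_nonneg q _⟩ y

theorem TotallyBounded.setProd {X Y : Type*} [UniformSpace X] [UniformSpace Y] {s : Set X}
    {t : Set Y} (hs : TotallyBounded s) (ht : TotallyBounded t) : TotallyBounded (s ×ˢ t) := by
  rw [totallyBounded_iff_ultrafilter] at hs ht ⊢
  intro f hf
  have hmem : s ×ˢ t ∈ f := Filter.le_principal_iff.1 hf
  refine cauchy_prod_iff.2 ⟨hs (f.map Prod.fst) ?_, ht (f.map Prod.snd) ?_⟩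
  · exact Filter.le_principal_iff.2 (Ultrafilter.mem_map.2 (Filter.mem_of_superset hmem fun x hx => hx.1))
  · exact Filter.le_principal_iff.2 (Ultrafilter.mem_map.2 (Filter.mem_of_superset hmem fun x hx => hx.2))

namespace OrderUnitSpace

section Induces

variable {A B : Type*} [AddCommGroup A] [Module ℝ A] [AddCommGroup B] [Module ℝ B]

theorem induces_fst_iff {L : Seminorm ℝ (A × B)} {LA : Seminorm ℝ A} :
    Induces L (LinearMap.fst ℝ A B) LA ↔
      (∀ a b, LA a ≤ L (a, b)) ∧ ∀ a t, LA a < t → ∃ b, L (a, b) < t := by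
  constructor
  · intro h
    refine ⟨fun a b => (h a).1 ⟨(a, b), rfl, rfl⟩, fun a t ht => ?_⟩
    obtain ⟨_, ⟨⟨a', b⟩, rfl, rfl⟩, -, hb⟩ := (h a).exists_between ht
    exact ⟨b, hb⟩
  · rintro ⟨h1, h2⟩ a
    refine ⟨?_, fun s hs => ?_⟩
    · rintro _ ⟨⟨a', b⟩, rfl, rfl⟩
      exact h1 _ _
    · refine le_of_forall_gt_imp_ge_of_dense fun t ht => ?_
      obtain ⟨b, hb⟩ := h2 a t ht
      exact (hs ⟨(a, b), rfl, rfl⟩).trans hb.le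

theorem induces_snd_iff {L : Seminorm ℝ (A × B)} {LB : Seminorm ℝ B} :
    Induces L (LinearMap.snd ℝ A B) LB ↔
      (∀ a b, LB b ≤ L (a, b)) ∧ ∀ b t, LB b < t → ∃ a, L (a, b) < t := by
  constructor
  · intro h
    refine ⟨fun a b => (h b).1 ⟨(a, b), rfl, rfl⟩, fun b t ht => ?_⟩
    obtain ⟨_, ⟨⟨a, b'⟩, rfl, rfl⟩, -, hb⟩ := (h b).exists_between ht
    exact ⟨a, hb⟩
  · rintro ⟨h1, h2⟩ b
    refine ⟨?_, fun s hs => ?_⟩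
    · rintro _ ⟨⟨a, b'⟩, rfl, rfl⟩
      exact h1 _ _
    · refine le_of_forall_gt_imp_ge_of_dense fun t ht => ?_
      obtain ⟨a, ha⟩ := h2 b t ht
      exact (hs ⟨(a, b), rfl, rfl⟩).trans ha.le

end Induces

variable {A : Type*} [NormedAddCommGroup A] [NormedSpace ℝ A] [PartialOrder A] [OrderUnitSpace A]
variable {B : Type*} [NormedAddCommGroup B] [NormedSpace ℝ B] [PartialOrder B] [OrderUnitSpace B]

theorem seminorm_add_smul_ordUnit {L : Seminorm ℝ A} (h : L ordUnit = 0) (a : A) (c : ℝ) :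
    L (a + c • ordUnit) = L a := by
  have key : ∀ (a : A) (c : ℝ), L (a + c • ordUnit) ≤ L a := fun a c => by
    refine (map_add_le_add L _ _).trans ?_
    rw [map_smul_eq_mul, h, mul_zero, add_zero]
  refine le_antisymm (key a c) ?_
  simpa using key (a + c • ordUnit) (-c)

theorem seminorm_smul_ordUnit {L : Seminorm ℝ A} (h : L ordUnit = 0) (c : ℝ) :
    L (c • ordUnit) = 0 := by
  rw [map_smul_eq_mul, h, mul_zero]

theorem IsLipNorm.map_ordUnit {L : Seminorm ℝ A} (h : IsLipNorm L) : L ordUnit = 0 :=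
  (h.eq_zero_iff _).2 ⟨1, (one_smul ℝ _).symm⟩

theorem exists_state_fst (μ : stateSpace A) :
    ∃ κ : stateSpace (A × B), ∀ c, (κ : WeakDual ℝ (A × B)) c = (μ : WeakDual ℝ A) c.1 :=
  exists_state_eq (((μ : WeakDual ℝ A) : A →L[ℝ] ℝ).toLinearMap ∘ₗ LinearMap.fst ℝ A B)
    (state_ordUnit μ) fun c => (le_abs_self _).trans
      ((abs_state_le μ c.1).trans (norm_fst_le c))

theorem exists_state_snd (ν : stateSpace B) :
    ∃ κ : stateSpace (A × B), ∀ c, (κ : WeakDual ℝ (A × B)) c = (ν : WeakDual ℝ B) c.2 :=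
  exists_state_eq (((ν : WeakDual ℝ B) : B →L[ℝ] ℝ).toLinearMap ∘ₗ LinearMap.snd ℝ A B)
    (state_ordUnit ν) fun c => (le_abs_self _).trans
      ((abs_state_le ν c.2).trans (norm_snd_le c))

end OrderUnitSpace

/-! ### Bridges, symmetry and the triangle inequality -/

namespace CompactQuantumMetricSpace

/-- A seminorm on `A ⊕ B` which induces the Lip-norms of `A` and `B`, vanishes on the order unit,
and for which every state of one space is within `r` of a state of the other. -/
structure IsBridge (A B : CompactQuantumMetricSpace.{u}) (r : ℝ)
    (L : Seminorm ℝ (A.carrier × B.carrier)) : Prop where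
  map_unit : L (ordUnit, ordUnit) = 0
  fst_le : ∀ a b, A.lip a ≤ L (a, b)
  snd_le : ∀ a b, B.lip b ≤ L (a, b)
  exists_snd : ∀ a t, A.lip a < t → ∃ b, L (a, b) < t
  exists_fst : ∀ b t, B.lip b < t → ∃ a, L (a, b) < t
  exists_state_snd : ∀ μ : stateSpace A.carrier, ∃ ν : stateSpace B.carrier, ∀ a b,
    |(μ : WeakDual ℝ A.carrier) a - (ν : WeakDual ℝ B.carrier) b| ≤ r * L (a, b)
  exists_state_fst : ∀ ν : stateSpace B.carrier, ∃ μ : stateSpace A.carrier, ∀ a b,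
    |(μ : WeakDual ℝ A.carrier) a - (ν : WeakDual ℝ B.carrier) b| ≤ r * L (a, b)

variable {A B C : CompactQuantumMetricSpace.{u}}

/-- One matched pair of states `μ₀`, `ν₀` is enough. It ties the constants in the two summands
together, which fixes the kernel; and on the unit ball normalised by `μ₀(a) = 0` it gives `|ν₀(b)| ≤
r`, so that only a compact range of constants is added to the two normalised balls. -/
theorem IsBridge.isLipNorm {r : ℝ} {L : Seminorm ℝ (A.carrier × B.carrier)}
    (h : IsBridge A B r L) (hr : 0 ≤ r) : IsLipNorm L := by
  obtain ⟨μ₀⟩ := nonempty_stateSpace (A := A.carrier)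
  obtain ⟨ν₀, hν₀⟩ := h.exists_state_snd μ₀
  obtain ⟨κ, hκ⟩ := OrderUnitSpace.exists_state_fst (B := B.carrier) μ₀
  refine isLipNorm_of_totallyBounded (fun c => ?_) κ ?_
  · constructor
    · obtain ⟨a, b⟩ := c
      intro h0
      obtain ⟨s, hs⟩ := (A.isLipNorm.eq_zero_iff a).1
        (le_antisymm (h0 ▸ h.fst_le a b) (apply_nonneg _ _))
      obtain ⟨t, ht⟩ := (B.isLipNorm.eq_zero_iff b).1
        (le_antisymm (h0 ▸ h.snd_le a b) (apply_nonneg _ _))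
      have h1 := hν₀ a b
      rw [h0, mul_zero, hs, ht, map_smul, map_smul, state_ordUnit, state_ordUnit] at h1
      have h2 : s = t := by simpa using sub_eq_zero.1 (abs_nonpos_iff.1 h1)
      exact ⟨s, by rw [hs, ht, h2]; rfl⟩
    · rintro ⟨s, rfl⟩
      exact seminorm_smul_ordUnit h.map_unit s
  · have hA := A.isLipNorm.totallyBounded μ₀
    have hB := B.isLipNorm.totallyBounded ν₀
    have hI := (isCompact_Icc (a := -r) (b := r)).totallyBounded
    -- `Ψ(a, b, s) = (a, b + s e)` puts back the constant removed by normalising `b` at `ν₀`.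
    let Ψ : A.carrier × B.carrier × ℝ →L[ℝ] A.carrier × B.carrier :=
      (ContinuousLinearMap.fst ℝ _ _).prod
        ((ContinuousLinearMap.fst ℝ _ _).comp (ContinuousLinearMap.snd ℝ _ _) +
          ((ContinuousLinearMap.snd ℝ _ _).comp
            (ContinuousLinearMap.snd ℝ A.carrier (B.carrier × ℝ))).smulRight ordUnit)
    refine ((hA.setProd (hB.setProd hI)).image Ψ.uniformContinuous).subset ?_
    rintro ⟨a, b⟩ ⟨hL, h0⟩
    rw [hκ] at h0
    set s := (ν₀ : WeakDual ℝ B.carrier) b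
    refine ⟨(a, b - s • ordUnit, s), ⟨⟨(h.fst_le a b).trans hL, h0⟩, ⟨?_, ?_⟩, ?_⟩, ?_⟩
    · rw [sub_eq_add_neg, ← neg_smul, seminorm_add_smul_ordUnit B.isLipNorm.map_ordUnit]
      exact (h.snd_le a b).trans hL
    · rw [map_sub, map_smul, state_ordUnit, smul_eq_mul, mul_one, sub_self]
    · have h1 := hν₀ a b
      have h0' : (μ₀ : WeakDual ℝ A.carrier) a = 0 := h0
      rw [h0', zero_sub, abs_neg] at h1
      exact abs_le.1 (h1.trans (mul_le_of_le_one_right hr hL))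
    · simp [Ψ]

theorem IsBridge.distq_le {r : ℝ} {L : Seminorm ℝ (A.carrier × B.carrier)}
    (h : IsBridge A B r L) (hr : 0 ≤ r) : distq A B ≤ ENNReal.ofReal r := by
  refine iInf₂_le_of_le L ⟨h.isLipNorm hr, induces_fst_iff.2 ⟨h.fst_le, h.exists_snd⟩,
    induces_snd_iff.2 ⟨h.snd_le, h.exists_fst⟩⟩ ?_
  refine @Metric.hausdorffEDist_le_of_mem_edist _ (lipEMetric L) _ _ _ ?_ ?_
  · rintro κ ⟨μ, hμ⟩
    obtain ⟨ν, hν⟩ := h.exists_state_snd μ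
    obtain ⟨κ', hκ'⟩ := OrderUnitSpace.exists_state_snd (A := A.carrier) ν
    refine ⟨κ', ⟨ν, hκ'⟩, (lipEMetric_le_iff hr).2 fun c hc => ?_⟩
    rw [hμ, hκ']
    exact (hν c.1 c.2).trans (mul_le_of_le_one_right hr hc)
  · rintro κ ⟨ν, hν⟩
    obtain ⟨μ, hμ⟩ := h.exists_state_fst ν
    obtain ⟨κ', hκ'⟩ := OrderUnitSpace.exists_state_fst (B := B.carrier) μ
    refine ⟨κ', ⟨μ, hκ'⟩, (lipEMetric_le_iff hr).2 fun c hc => ?_⟩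
    rw [hν, hκ', abs_sub_comm]
    exact (hμ c.1 c.2).trans (mul_le_of_le_one_right hr hc)

/-- Together with `IsBridge.distq_le`, this replaces `distq` by the infimum of the lengths of
bridges. -/
theorem exists_isBridge_of_distq_lt {r : ℝ} (h : distq A B < ENNReal.ofReal r) :
    ∃ L, IsBridge A B r L := by
  have hr : 0 ≤ r := (ENNReal.ofReal_pos.1 (bot_le.trans_lt h)).le
  obtain ⟨L, hL⟩ := iInf_lt_iff.1 h
  obtain ⟨⟨hlip, hA, hB⟩, hd⟩ := iInf_lt_iff.1 hL
  rw [induces_fst_iff] at hA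
  rw [induces_snd_iff] at hB
  have key : ∀ (μ : stateSpace A.carrier) (ν : stateSpace B.carrier)
      (κ κ' : stateSpace (A.carrier × B.carrier)),
      (∀ c, (κ : WeakDual ℝ (A.carrier × B.carrier)) c = (μ : WeakDual ℝ A.carrier) c.1) →
      (∀ c, (κ' : WeakDual ℝ (A.carrier × B.carrier)) c = (ν : WeakDual ℝ B.carrier) c.2) →
      (lipEMetric L).edist κ κ' < ENNReal.ofReal r → ∀ a b,
      |(μ : WeakDual ℝ A.carrier) a - (ν : WeakDual ℝ B.carrier) b| ≤ r * L (a, b) := by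
    intro μ ν κ κ' hκ hκ' hlt a b
    have h1 := abs_le_mul_seminorm L
      ((κ : WeakDual ℝ (A.carrier × B.carrier)) - (κ' : WeakDual ℝ (A.carrier × B.carrier)) :
        A.carrier × B.carrier →L[ℝ] ℝ).toLinearMap ((lipEMetric_le_iff hr).1 hlt.le) (a, b)
    rw [← hκ (a, b), ← hκ' (a, b)]
    exact h1
  refine ⟨L, hlip.map_ordUnit, hA.1, hB.1, hA.2, hB.2, fun μ => ?_, fun ν => ?_⟩
  · obtain ⟨κ, hκ⟩ := OrderUnitSpace.exists_state_fst (B := B.carrier) μ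
    obtain ⟨κ', ⟨ν, hν⟩, hlt⟩ :=
      @Metric.exists_edist_lt_of_hausdorffEDist_lt _ (lipEMetric L) κ _ _ _ (show κ ∈ stateImage _ from ⟨μ, hκ⟩) hd
    exact ⟨ν, key μ ν κ κ' hκ hν hlt⟩
  · obtain ⟨κ, hκ⟩ := OrderUnitSpace.exists_state_snd (A := A.carrier) ν
    rw [@Metric.hausdorffEDist_comm _ (lipEMetric L)] at hd
    obtain ⟨κ', ⟨μ, hμ⟩, hlt⟩ :=
      @Metric.exists_edist_lt_of_hausdorffEDist_lt _ (lipEMetric L) κ _ _ _ (show κ ∈ stateImage _ from ⟨ν, hκ⟩) hd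
    exact ⟨μ, key μ ν κ' κ hμ hκ (((lipEMetric L).edist_comm _ _).trans_lt hlt)⟩

theorem IsBridge.symm {r : ℝ} {L : Seminorm ℝ (A.carrier × B.carrier)} (h : IsBridge A B r L) :
    IsBridge B A r (L.comp (LinearEquiv.prodComm ℝ B.carrier A.carrier).toLinearMap) where
  map_unit := h.map_unit
  fst_le b a := h.snd_le a b
  snd_le b a := h.fst_le a b
  exists_snd := h.exists_fst
  exists_fst := h.exists_snd
  exists_state_snd ν := by
    obtain ⟨μ, hμ⟩ := h.exists_state_fst ν
    exact ⟨μ, fun b a => (abs_sub_comm _ _).trans_le (hμ a b)⟩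
  exists_state_fst μ := by
    obtain ⟨ν, hν⟩ := h.exists_state_snd μ
    exact ⟨ν, fun b a => (abs_sub_comm _ _).trans_le (hν a b)⟩

/-- The composite is `N(a, c) = inf_b max (L(a, b), M(b, c))`. Lifting `a` to `b` keeps `L_B(b)`
below the same strict bound, so the lift continues to `c`; matched states are composed through `B`.
-/
theorem IsBridge.trans {r s : ℝ} {L : Seminorm ℝ (A.carrier × B.carrier)}
    {M : Seminorm ℝ (B.carrier × C.carrier)} (h : IsBridge A B r L) (h' : IsBridge B C s M)
    (hr : 0 ≤ r) (hs : 0 ≤ s) : ∃ N, IsBridge A C (r + s) N := by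
  let p : (A.carrier × C.carrier) × B.carrier →ₗ[ℝ] A.carrier × B.carrier :=
    (LinearMap.fst ℝ _ _ ∘ₗ LinearMap.fst ℝ _ _).prod (LinearMap.snd ℝ _ _)
  let q : (A.carrier × C.carrier) × B.carrier →ₗ[ℝ] B.carrier × C.carrier :=
    (LinearMap.snd ℝ _ _).prod (LinearMap.snd ℝ _ _ ∘ₗ LinearMap.fst ℝ _ _)
  let Q : Seminorm ℝ ((A.carrier × C.carrier) × B.carrier) := L.comp p ⊔ M.comp q
  have hQ : ∀ a b c, Q ((a, c), b) = max (L (a, b)) (M (b, c)) := fun a b c => rfl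
  have key : ∀ (μ : stateSpace A.carrier) (ν : stateSpace B.carrier) (ξ : stateSpace C.carrier),
      (∀ a b, |(μ : WeakDual ℝ A.carrier) a - (ν : WeakDual ℝ B.carrier) b| ≤ r * L (a, b)) →
      (∀ b c, |(ν : WeakDual ℝ B.carrier) b - (ξ : WeakDual ℝ C.carrier) c| ≤ s * M (b, c)) →
      ∀ a c, |(μ : WeakDual ℝ A.carrier) a - (ξ : WeakDual ℝ C.carrier) c| ≤
        (r + s) * Q.infFiber (a, c) := by
    intro μ ν ξ h1 h2 a c
    rw [Seminorm.infFiber_apply, Real.mul_iInf_of_nonneg (add_nonneg hr hs)]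
    refine le_ciInf fun b => ?_
    rw [hQ, add_mul]
    refine (abs_sub_le _ ((ν : WeakDual ℝ B.carrier) b) _).trans
      (add_le_add ((h1 a b).trans ?_) ((h2 b c).trans ?_))
    · exact mul_le_mul_of_nonneg_left (le_max_left _ _) hr
    · exact mul_le_mul_of_nonneg_left (le_max_right _ _) hs
  refine ⟨Q.infFiber, ?_, fun a c => ?_, fun a c => ?_, fun a t ht => ?_, fun c t ht => ?_,
    fun μ => ?_, fun ξ => ?_⟩
  · refine le_antisymm ((Q.infFiber_le _ ordUnit).trans ?_) (apply_nonneg _ _)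
    rw [hQ, h.map_unit, h'.map_unit, max_self]
  · exact le_ciInf fun b => (h.fst_le a b).trans (le_max_left _ _)
  · exact le_ciInf fun b => (h'.snd_le b c).trans (le_max_right _ _)
  · obtain ⟨b, hb⟩ := h.exists_snd a t ht
    obtain ⟨c, hc⟩ := h'.exists_snd b t ((h.snd_le a b).trans_lt hb)
    exact ⟨c, (Q.infFiber_le _ b).trans_lt (max_lt hb hc)⟩
  · obtain ⟨b, hb⟩ := h'.exists_fst c t ht
    obtain ⟨a, ha⟩ := h.exists_fst b t ((h'.fst_le b c).trans_lt hb)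
    exact ⟨a, (Q.infFiber_le _ b).trans_lt (max_lt ha hb)⟩
  · obtain ⟨ν, hν⟩ := h.exists_state_snd μ
    obtain ⟨ξ, hξ⟩ := h'.exists_state_snd ν
    exact ⟨ξ, key μ ν ξ hν hξ⟩
  · obtain ⟨ν, hν⟩ := h'.exists_state_fst ξ
    obtain ⟨μ, hμ⟩ := h.exists_state_fst ν
    exact ⟨μ, key μ ν ξ hμ hν⟩

theorem distq_comm (A B : CompactQuantumMetricSpace.{u}) : distq A B = distq B A := by
  have key : ∀ A B : CompactQuantumMetricSpace.{u}, distq B A ≤ distq A B := fun A B => by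
    refine le_of_forall_gt_imp_ge_of_dense fun x hx => ?_
    obtain ⟨r, hr, hrx⟩ := ENNReal.lt_iff_exists_nnreal_btwn.1 hx
    rw [← ENNReal.ofReal_coe_nnreal] at hr
    obtain ⟨L, hL⟩ := exists_isBridge_of_distq_lt hr
    exact (hL.symm.distq_le r.2).trans (ENNReal.ofReal_coe_nnreal.trans_le hrx.le)
  exact le_antisymm (key B A) (key A B)

theorem distq_triangle (A B C : CompactQuantumMetricSpace.{u}) :
    distq A C ≤ distq A B + distq B C := by
  refine ENNReal.le_of_forall_pos_le_add fun ε hε hlt => ?_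
  obtain ⟨hx, hy⟩ := ENNReal.add_lt_top.1 hlt
  have hε' : (0 : ℝ) < ε / 2 := by have : (0 : ℝ) < ε := hε; linarith
  have aux : ∀ x : ℝ≥0∞, x < ⊤ → x < ENNReal.ofReal (x.toReal + ε / 2) := fun x hx => by
    rw [ENNReal.lt_ofReal_iff_toReal_lt hx.ne]
    linarith
  obtain ⟨L, hL⟩ := exists_isBridge_of_distq_lt (aux _ hx)
  obtain ⟨M, hM⟩ := exists_isBridge_of_distq_lt (aux _ hy)
  obtain ⟨N, hN⟩ := hL.trans hM (by positivity) (by positivity)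
  refine (hN.distq_le (by positivity)).trans (le_of_eq ?_)
  rw [add_add_add_comm, add_halves, ENNReal.ofReal_add (by positivity) (by positivity),
    ENNReal.ofReal_add (by positivity) (by positivity), ENNReal.ofReal_toReal hx.ne,
    ENNReal.ofReal_toReal hy.ne, ENNReal.ofReal_coe_nnreal]

end CompactQuantumMetricSpace

/-! ### Bridges from norms and amalgamation; finiteness -/

namespace OrderUnitSpace

variable {A : Type*} [NormedAddCommGroup A] [NormedSpace ℝ A] [PartialOrder A] [OrderUnitSpace A]
variable {B : Type*} [NormedAddCommGroup B] [NormedSpace ℝ B] [PartialOrder B] [OrderUnitSpace B]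

/-- A seminorm on `A ⊕ B` that restricts to the two norms and vanishes on the order unit matches
every state of `A` with a state of `B`. -/
theorem exists_state_forall_abs_sub_le (N : Seminorm ℝ (A × B)) (hA : ∀ a, ‖a‖ ≤ N (a, 0))
    (hB : ∀ b, N (0, b) ≤ ‖b‖) (he : N (ordUnit, ordUnit) = 0) (μ : stateSpace A) :
    ∃ ν : stateSpace B, ∀ a b, |(μ : WeakDual ℝ A) a - (ν : WeakDual ℝ B) b| ≤ N (a, b) := by
  let m : A →ₗ[ℝ] ℝ := ((μ : WeakDual ℝ A) : A →L[ℝ] ℝ).toLinearMap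
  let f : A × B →ₗ.[ℝ] ℝ :=
    ⟨LinearMap.ker (LinearMap.snd ℝ A B), (-(m ∘ₗ LinearMap.fst ℝ A B)).domRestrict _⟩
  -- Hahn–Banach extends `-μ` on `A ⊕ 0` to `g ≤ N`, so that `g(a, b) = ν(b) - μ(a)` with `ν` the
  -- restriction to `B`. Since `N(e, e) = 0`, also `g(e, e) = 0`, whence `ν(e) = 1`.
  obtain ⟨g, hgf, hgN⟩ := exists_extension_of_le_sublinear f N
    (fun c hc x => by rw [map_smul_eq_mul, Real.norm_eq_abs, abs_of_pos hc])
    (fun x y => map_add_le_add N x y) (by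
      rintro ⟨⟨a, b⟩, hb⟩
      obtain rfl : b = 0 := hb
      exact (neg_le_abs _).trans ((abs_state_le μ a).trans (hA a)))
  have hg : ∀ a b, g (a, b) = g (0, b) - (μ : WeakDual ℝ A) a := fun a b => by
    have h1 : g (a, 0) = -(μ : WeakDual ℝ A) a := hgf ⟨(a, 0), rfl⟩
    have h2 : ((a, b) : A × B) = (a, 0) + (0, b) := by simp
    rw [h2, map_add, h1]
    ring
  have hge : g (0, ordUnit) = 1 := by
    have h1 := hgN (ordUnit, ordUnit)
    have h2 := hgN (-(ordUnit, ordUnit))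
    rw [map_neg g, map_neg_eq_map N, he, hg, state_ordUnit] at h2
    rw [he, hg, state_ordUnit] at h1
    linarith
  obtain ⟨ν, hν⟩ := exists_state_eq (g ∘ₗ LinearMap.inr ℝ A B) hge
    fun b => (hgN (0, b)).trans (hB b)
  refine ⟨ν, fun a b => ?_⟩
  have h1 := hgN (a, b)
  have h2 := hgN (-(a, b))
  rw [map_neg g, map_neg_eq_map N] at h2
  have h3 : (ν : WeakDual ℝ B) b = g (0, b) := hν b
  rw [hg] at h1 h2
  rw [h3, abs_le]
  constructor <;> linarith

end OrderUnitSpace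

namespace CompactQuantumMetricSpace

variable {A B : CompactQuantumMetricSpace.{u}}

/-- The bridge is `max (L_A, L_B, N / γ)`: the closeness of the Lip-balls gives the quotient
conditions by scaling, and state matching within `N ≤ γ L` comes from Hahn–Banach. -/
theorem exists_isBridge_of_seminorm (N : Seminorm ℝ (A.carrier × B.carrier))
    (hA : ∀ a, N (a, 0) = ‖a‖) (hB : ∀ b, N (0, b) = ‖b‖) (he : N (ordUnit, ordUnit) = 0)
    {γ : ℝ} (hγ : 0 < γ) (h1 : ∀ a, A.lip a ≤ 1 → ∃ b, B.lip b ≤ 1 ∧ N (a, b) ≤ γ)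
    (h2 : ∀ b, B.lip b ≤ 1 → ∃ a, A.lip a ≤ 1 ∧ N (a, b) ≤ γ) :
    ∃ L, IsBridge A B γ L := by
  have hγ' : 0 ≤ γ⁻¹ := inv_nonneg.2 hγ.le
  let L : Seminorm ℝ (A.carrier × B.carrier) :=
    (A.lip.comp (LinearMap.fst ℝ _ _) ⊔ B.lip.comp (LinearMap.snd ℝ _ _)) ⊔ γ⁻¹.toNNReal • N
  have hL : ∀ a b, L (a, b) = max (max (A.lip a) (B.lip b)) (γ⁻¹ * N (a, b)) := fun a b => by
    change max (max (A.lip a) (B.lip b)) ((γ⁻¹.toNNReal : ℝ) * N (a, b)) = _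
    rw [Real.coe_toNNReal _ hγ']
  have hN : ∀ a b, N (a, b) ≤ γ * L (a, b) := fun a b => by
    rw [← inv_mul_le_iff₀ hγ, hL]
    exact le_max_right _ _
  have hunit : ∀ a b, A.lip a ≤ 1 → B.lip b ≤ 1 → N (a, b) ≤ γ → L (a, b) ≤ 1 := by
    intro a b ha hb hab
    rw [hL]
    refine max_le (max_le ha hb) ?_
    rwa [inv_mul_le_iff₀ hγ, mul_one]
  have hscale : ∀ (s t : ℝ) (c : A.carrier × B.carrier), 0 < s → s < t → L c ≤ 1 →
      L (s • c) < t := fun s t c hs hst hc => by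
    rw [map_smul_eq_mul, Real.norm_eq_abs, abs_of_pos hs]
    exact (mul_le_of_le_one_right hs.le hc).trans_lt hst
  have hinv : ∀ {E : Type u} [AddCommGroup E] [Module ℝ E] (q : Seminorm ℝ E) (x : E) (s : ℝ),
      0 < s → q x < s → q (s⁻¹ • x) ≤ 1 := fun q x s hs hqs => by
    rw [map_smul_eq_mul, Real.norm_eq_abs, abs_of_pos (inv_pos.2 hs), inv_mul_le_iff₀ hs, mul_one]
    exact hqs.le
  refine ⟨L, ?_, fun a b => ?_, fun a b => ?_, fun a t ht => ?_, fun b t ht => ?_, fun μ => ?_,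
    fun ν => ?_⟩
  · rw [hL, he, A.isLipNorm.map_ordUnit, B.isLipNorm.map_ordUnit]
    simp
  · exact (le_max_left _ _).trans (le_max_left _ _)
  · exact (le_max_right _ _).trans (le_max_left _ _)
  · obtain ⟨s, hs, hst⟩ := exists_between ht
    have hs0 : 0 < s := (apply_nonneg _ _).trans_lt hs
    obtain ⟨b, hb, hab⟩ := h1 _ (hinv A.lip a s hs0 hs)
    refine ⟨s • b, ?_⟩
    have := hscale s t _ hs0 hst (hunit _ _ (hinv A.lip a s hs0 hs) hb hab)
    rwa [Prod.smul_mk, smul_inv_smul₀ hs0.ne'] at this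
  · obtain ⟨s, hs, hst⟩ := exists_between ht
    have hs0 : 0 < s := (apply_nonneg _ _).trans_lt hs
    obtain ⟨a, ha, hab⟩ := h2 _ (hinv B.lip b s hs0 hs)
    refine ⟨s • a, ?_⟩
    have := hscale s t _ hs0 hst (hunit _ _ ha (hinv B.lip b s hs0 hs) hab)
    rwa [Prod.smul_mk, smul_inv_smul₀ hs0.ne'] at this
  · obtain ⟨ν, hν⟩ := exists_state_forall_abs_sub_le N (fun a => (hA a).ge) (fun b => (hB b).le)
      he μ
    exact ⟨ν, fun a b => (hν a b).trans (hN a b)⟩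
  · obtain ⟨μ, hμ⟩ := exists_state_forall_abs_sub_le
      (N.comp (LinearEquiv.prodComm ℝ B.carrier A.carrier).toLinearMap) (fun b => (hB b).ge)
      (fun a => (hA a).le) he ν
    exact ⟨μ, fun a b => (abs_sub_comm _ _).trans_le ((hμ b a).trans (hN a b))⟩

/-- Bridges by amalgamation: two linear maps from a common space with almost equal norms. -/
theorem exists_isBridge_of_amalgam {V : Type*} [AddCommGroup V] [Module ℝ V]
    (S : V →ₗ[ℝ] A.carrier) (T : V →ₗ[ℝ] B.carrier) (q : Seminorm ℝ V)
    (hq : ∀ v, |‖S v‖ - ‖T v‖| ≤ q v) {v₀ : V} (hS : S v₀ = ordUnit) (hT : T v₀ = ordUnit)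
    (hv₀ : q v₀ = 0) {γ : ℝ} (hγ : 0 < γ)
    (h1 : ∀ a, A.lip a ≤ 1 → ∃ v, B.lip (T v) ≤ 1 ∧ ‖a - S v‖ + q v ≤ γ)
    (h2 : ∀ b, B.lip b ≤ 1 → ∃ v, A.lip (S v) ≤ 1 ∧ ‖b - T v‖ + q v ≤ γ) :
    ∃ L, IsBridge A B γ L := by
  let p₁ : (A.carrier × B.carrier) × V →ₗ[ℝ] A.carrier :=
    LinearMap.fst ℝ _ _ ∘ₗ LinearMap.fst ℝ _ _ - S ∘ₗ LinearMap.snd ℝ _ _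
  let p₂ : (A.carrier × B.carrier) × V →ₗ[ℝ] B.carrier :=
    LinearMap.snd ℝ _ _ ∘ₗ LinearMap.fst ℝ _ _ - T ∘ₗ LinearMap.snd ℝ _ _
  -- The infimum over `v` is the distance from `a` to `b` in the amalgam, where passing from `S v`
  -- to `T v` costs `q v`. The hypothesis `hq` is what keeps the amalgam from shrinking the norm of
  -- either summand.
  let Q : Seminorm ℝ ((A.carrier × B.carrier) × V) :=
    (normSeminorm ℝ A.carrier).comp p₁ + (normSeminorm ℝ B.carrier).comp p₂ +
      q.comp (LinearMap.snd ℝ _ _)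
  have hQ : ∀ a b v, Q ((a, b), v) = ‖a - S v‖ + ‖b - T v‖ + q v := fun a b v => rfl
  have hle : ∀ a b v, Q.infFiber (a, b) ≤ ‖a - S v‖ + ‖b - T v‖ + q v := fun a b v =>
    Q.infFiber_le (a, b) v
  refine exists_isBridge_of_seminorm Q.infFiber (fun a => le_antisymm ?_ ?_)
    (fun b => le_antisymm ?_ ?_) (le_antisymm ?_ (apply_nonneg _ _)) hγ (fun a ha => ?_)
    (fun b hb => ?_)
  · simpa using hle a 0 0
  · refine le_ciInf fun v => ?_
    rw [hQ, zero_sub, norm_neg]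
    have h3 := (abs_le.1 (hq v)).2
    have h4 := norm_sub_norm_le a (S v)
    linarith
  · simpa using hle 0 b 0
  · refine le_ciInf fun v => ?_
    rw [hQ, zero_sub, norm_neg]
    have h3 := (abs_le.1 (hq v)).1
    have h4 := norm_sub_norm_le b (T v)
    linarith
  · refine (hle ordUnit ordUnit v₀).trans ?_
    rw [hS, hT, hv₀]
    simp
  · obtain ⟨v, hv, h⟩ := h1 a ha
    refine ⟨T v, hv, (hle _ _ v).trans ?_⟩
    simpa using h
  · obtain ⟨v, hv, h⟩ := h2 b hb
    refine ⟨S v, hv, (hle _ _ v).trans ?_⟩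
    simpa using h

theorem exists_norm_sub_smul_ordUnit_le (A : CompactQuantumMetricSpace.{u}) :
    ∃ r : ℝ, ∀ a, A.lip a ≤ 1 → ∃ c : ℝ, ‖a - c • ordUnit‖ ≤ r := by
  obtain ⟨μ₀⟩ := nonempty_stateSpace (A := A.carrier)
  obtain ⟨r, hr⟩ := A.isLipNorm.exists_forall_abs_sub_le μ₀
  refine ⟨r, fun a ha => ⟨(μ₀ : WeakDual ℝ A.carrier) a, norm_le_of_forall_state fun μ => ?_⟩⟩
  rw [map_sub, map_smul, state_ordUnit, smul_eq_mul, mul_one]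
  exact hr μ a ha

theorem distq_lt_top (A B : CompactQuantumMetricSpace.{u}) : distq A B < ⊤ := by
  obtain ⟨r, hr⟩ := A.exists_norm_sub_smul_ordUnit_le
  obtain ⟨s, hs⟩ := B.exists_norm_sub_smul_ordUnit_le
  suffices h : ∃ L, IsBridge A B (max (max r s) 1) L by
    obtain ⟨L, hL⟩ := h
    exact (hL.distq_le (by positivity)).trans_lt ENNReal.ofReal_lt_top
  -- Amalgamate along the constants `ℝ e`, at no cost. The `1` in the length only ensures
  -- positivity.
  refine exists_isBridge_of_amalgam
    (LinearMap.toSpanSingleton ℝ _ ordUnit) (LinearMap.toSpanSingleton ℝ _ ordUnit) 0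
    (fun v => by simp [norm_smul, norm_ordUnit]) (v₀ := 1) (by simp) (by simp) (by simp)
    (by positivity) (fun a ha => ?_) (fun b hb => ?_)
  · obtain ⟨c, hc⟩ := hr a ha
    refine ⟨c, ?_, ?_⟩
    · rw [LinearMap.toSpanSingleton_apply, seminorm_smul_ordUnit B.isLipNorm.map_ordUnit]
      exact zero_le_one
    · simpa using Or.inl (Or.inl hc)
  · obtain ⟨c, hc⟩ := hs b hb
    refine ⟨c, ?_, ?_⟩
    · rw [LinearMap.toSpanSingleton_apply, seminorm_smul_ordUnit A.isLipNorm.map_ordUnit]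
      exact zero_le_one
    · simpa using Or.inl (Or.inr hc)

/-! ### Finite nets, profiles and the countable discretization -/

/-- Finite nets for the Lip-ball modulo constants. -/
theorem exists_finite_net (A : CompactQuantumMetricSpace.{u}) {ε : ℝ} (hε : 0 < ε) :
    ∃ (n : ℕ) (x : Fin n → A.carrier), (∀ i, A.lip (x i) ≤ 1) ∧
      ∀ a, A.lip a ≤ 1 → ∃ i, ∃ c : ℝ, ‖a - (x i + c • ordUnit)‖ ≤ ε := by
  obtain ⟨μ₀⟩ := nonempty_stateSpace (A := A.carrier)
  obtain ⟨t, hts, htf, hcov⟩ :=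
    Metric.finite_approx_of_totallyBounded (A.isLipNorm.totallyBounded μ₀) ε hε
  have : Finite t := htf
  obtain ⟨n, ⟨f⟩⟩ := Finite.exists_equiv_fin t
  refine ⟨n, fun i => f.symm i, fun i => (hts (f.symm i).2).1, fun a ha => ?_⟩
  have hmem : a + (-(μ₀ : WeakDual ℝ A.carrier) a) • ordUnit ∈
      {a | A.lip a ≤ 1 ∧ (μ₀ : WeakDual ℝ A.carrier) a = 0} := by
    refine ⟨?_, ?_⟩
    · rwa [seminorm_add_smul_ordUnit A.isLipNorm.map_ordUnit]
    · rw [map_add, map_smul, state_ordUnit, smul_eq_mul, mul_one, add_neg_cancel]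
  obtain ⟨y, hy, hay⟩ := Set.mem_iUnion₂.1 (hcov hmem)
  rw [Metric.mem_ball, dist_eq_norm] at hay
  refine ⟨f ⟨y, hy⟩, (μ₀ : WeakDual ℝ A.carrier) a, le_trans (le_of_eq ?_) hay.le⟩
  simp only [Equiv.symm_apply_apply, neg_smul]
  congr 1
  abel

/-- The function `l ↦ max (∑ lᵢ xᵢ)` on the unit ball of `ℝⁿ`. -/
noncomputable def profile {n : ℕ} (x : Fin n → A.carrier) :
    C(Metric.closedBall (0 : Fin n → ℝ) 1, ℝ) where
  toFun l := ordSup (Fintype.linearCombination ℝ x (l : Fin n → ℝ))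
  continuous_toFun := by
    have h : LipschitzWith 1 (ordSup : A.carrier → ℝ) := LipschitzWith.of_dist_le_mul fun a b => by
      rw [Real.dist_eq, dist_eq_norm, NNReal.coe_one, one_mul]
      exact abs_ordSup_sub_le a b
    exact h.continuous.comp ((LinearMap.continuous_of_finiteDimensional _).comp
      continuous_subtype_val)

theorem abs_ordSup_linearCombination_sub_le {n : ℕ} {x : Fin n → A.carrier} {y : Fin n → B.carrier}
    {δ : ℝ} (h : dist (profile x) (profile y) ≤ δ) (l : Fin n → ℝ) :
    |ordSup (Fintype.linearCombination ℝ x l) - ordSup (Fintype.linearCombination ℝ y l)| ≤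
      δ * ‖l‖ := by
  rcases eq_or_ne l 0 with rfl | hl
  · have h0 : ∀ C : CompactQuantumMetricSpace.{u}, ordSup (0 : C.carrier) = 0 := fun C => by
      have h1 := ordSup_smul (0 : C.carrier) two_pos
      rw [smul_zero] at h1
      linarith
    simp [h0]
  · have hpos : 0 < ‖l‖ := norm_pos_iff.2 hl
    have hmem : ‖l‖⁻¹ • l ∈ Metric.closedBall (0 : Fin n → ℝ) 1 := by
      rw [mem_closedBall_zero_iff, norm_smul, norm_inv, norm_norm, inv_mul_cancel₀ hpos.ne']
    have h1 := (ContinuousMap.dist_apply_le_dist (f := profile x) (g := profile y)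
      ⟨_, hmem⟩).trans h
    rw [Real.dist_eq] at h1
    change |ordSup (Fintype.linearCombination ℝ x (‖l‖⁻¹ • l)) -
      ordSup (Fintype.linearCombination ℝ y (‖l‖⁻¹ • l))| ≤ δ at h1
    rw [map_smul, map_smul, ordSup_smul _ (inv_pos.2 hpos), ordSup_smul _ (inv_pos.2 hpos),
      ← mul_sub, abs_mul, abs_of_pos (inv_pos.2 hpos), inv_mul_le_iff₀ hpos] at h1
    linarith

theorem abs_norm_sub_norm_le {a : A.carrier} {b : B.carrier} {r : ℝ}
    (h : |ordSup a - ordSup b| ≤ r) (h' : |ordSup (-a) - ordSup (-b)| ≤ r) :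
    |‖a‖ - ‖b‖| ≤ r := by
  rw [norm_eq_max_ordSup, norm_eq_max_ordSup]
  exact (abs_max_sub_max_le_max _ _ _ _).trans (max_le h h')

/-- Amalgamate along `ℝⁿ × ℝ`, mapped to the combinations of the net points and the unit. Adding `c
e` shifts `ordSup` by `c` on both sides, so constants cost nothing and the profile on a compact ball
controls the norms on the whole span; this is the advantage of `ordSup` over the norm. -/
theorem distq_le_of_profile {n : ℕ} {x : Fin n → A.carrier} {y : Fin n → B.carrier} {δ ε : ℝ}
    (hδ : 0 ≤ δ) (hε : 0 < ε)
    (hx : ∀ i, A.lip (x i) ≤ 1) (hy : ∀ i, B.lip (y i) ≤ 1)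
    (hx' : ∀ a, A.lip a ≤ 1 → ∃ i, ∃ c : ℝ, ‖a - (x i + c • ordUnit)‖ ≤ ε)
    (hy' : ∀ b, B.lip b ≤ 1 → ∃ i, ∃ c : ℝ, ‖b - (y i + c • ordUnit)‖ ≤ ε)
    (h : dist (profile x) (profile y) ≤ δ) : distq A B ≤ ENNReal.ofReal (ε + δ) := by
  let S : (Fin n → ℝ) × ℝ →ₗ[ℝ] A.carrier :=
    (Fintype.linearCombination ℝ x).coprod (LinearMap.toSpanSingleton ℝ _ ordUnit)
  let T : (Fin n → ℝ) × ℝ →ₗ[ℝ] B.carrier :=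
    (Fintype.linearCombination ℝ y).coprod (LinearMap.toSpanSingleton ℝ _ ordUnit)
  let q : Seminorm ℝ ((Fin n → ℝ) × ℝ) :=
    δ.toNNReal • (normSeminorm ℝ (Fin n → ℝ)).comp (LinearMap.fst ℝ _ _)
  have hq : ∀ v, q v = δ * ‖v.1‖ := fun v => by
    change (δ.toNNReal : ℝ) * ‖v.1‖ = _
    rw [Real.coe_toNNReal _ hδ]
  have hSapp : ∀ i c, S (Pi.single i 1, c) = x i + c • ordUnit := fun i c => by
    simp [S]
  have hTapp : ∀ i c, T (Pi.single i 1, c) = y i + c • ordUnit := fun i c => by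
    simp [T]
  -- The basis vectors have sup norm 1, so exchanging a net point for its partner costs exactly `δ`.
  have hsingle : ∀ i c, q (Pi.single i 1, c) = δ := fun i c => by
    rw [hq]
    simp [Pi.norm_single]
  suffices h : ∃ L, IsBridge A B (ε + δ) L by
    obtain ⟨L, hL⟩ := h
    exact hL.distq_le (by positivity)
  refine exists_isBridge_of_amalgam S T q (fun v => ?_) (v₀ := (0, 1)) (by simp [S])
    (by simp [T]) (by simp [hq]) (by positivity) (fun a ha => ?_) (fun b hb => ?_)
  · obtain ⟨l, c⟩ := v
    rw [hq]
    have key : ∀ (l : Fin n → ℝ) (c : ℝ), |ordSup (S (l, c)) - ordSup (T (l, c))| ≤ δ * ‖l‖ := by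
      intro l c
      have hS : S (l, c) = Fintype.linearCombination ℝ x l + c • ordUnit := rfl
      have hT : T (l, c) = Fintype.linearCombination ℝ y l + c • ordUnit := rfl
      rw [hS, hT, ordSup_add_smul_ordUnit, ordSup_add_smul_ordUnit, add_sub_add_right_eq_sub]
      exact abs_ordSup_linearCombination_sub_le h l
    refine abs_norm_sub_norm_le (key l c) ?_
    rw [← map_neg, ← map_neg]
    exact (key (-l) (-c)).trans_eq (by rw [norm_neg])
  · obtain ⟨i, c, hc⟩ := hx' a ha
    refine ⟨(Pi.single i 1, c), ?_, ?_⟩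
    · rw [hTapp, seminorm_add_smul_ordUnit B.isLipNorm.map_ordUnit]
      exact hy i
    · rw [hSapp, hsingle]
      exact add_le_add_left hc _
  · obtain ⟨i, c, hc⟩ := hy' b hb
    refine ⟨(Pi.single i 1, c), ?_, ?_⟩
    · rw [hSapp, seminorm_add_smul_ordUnit A.isLipNorm.map_ordUnit]
      exact hx i
    · rw [hTapp, hsingle]
      exact add_le_add_left hc _

/-- Up to `ε`, a compact quantum metric space is determined by countably many data. -/
theorem exists_countable_discretization {ε : ℝ} (hε : 0 < ε) :
    ∃ F : CompactQuantumMetricSpace.{u} → ℕ × ℕ, ∀ A B, F A = F B →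
      distq A B ≤ ENNReal.ofReal ε := by
  have hε' : 0 < ε / 2 := half_pos hε
  choose n x hx hx' using fun A : CompactQuantumMetricSpace.{u} => A.exists_finite_net hε'
  -- The index of a member of a fixed dense sequence within `ε / 4` of the profile; equal indices
  -- give profiles within `ε / 2`.
  choose k hk using fun A : CompactQuantumMetricSpace.{u} =>
    (TopologicalSpace.denseRange_denseSeq
      C(Metric.closedBall (0 : Fin (n A) → ℝ) 1, ℝ)).exists_dist_lt (profile (x A))
      (half_pos hε')
  refine ⟨fun A => (n A, k A), fun A B h => ?_⟩
  have hn : n A = n B := congrArg Prod.fst h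
  have hkk : k A = k B := congrArg Prod.snd h
  have hxA := hx A
  have hxA' := hx' A
  have hkA := hk A
  have hxB := hx B
  have hxB' := hx' B
  have hkB := hk B
  -- The type of the profile depends on the size of the net; the nets become variables so that the
  -- two sizes can be identified.
  generalize x A = xA at *
  generalize x B = xB at *
  rw [← hkk] at hkB
  generalize n A = m at *
  subst hn
  refine (distq_le_of_profile hε'.le hε' hxA hxB hxA' hxB' ?_).trans_eq (by rw [add_halves])
  refine (dist_triangle_right _ _ _).trans ((add_le_add hkA.le hkB.le).trans_eq ?_)
  rw [add_halves]

end CompactQuantumMetricSpace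

/-! ### The completion; isometric spaces are at distance zero -/

namespace CompactQuantumMetricSpace

variable {A B : CompactQuantumMetricSpace.{u}}

section Completion

theorem exists_norm_sub_lt (x : A.Compl) {ε : ℝ} (hε : 0 < ε) :
    ∃ a : A.carrier, ‖(a : A.Compl) - x‖ < ε := by
  obtain ⟨a, ha⟩ := UniformSpace.Completion.denseRange_coe.exists_dist_lt x hε
  exact ⟨a, by rwa [dist_comm, dist_eq_norm] at ha⟩

theorem exists_nonneg_norm_sub_lt {x : A.Compl} (hx : x ∈ A.complPos) {ε : ℝ} (hε : 0 < ε) :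
    ∃ a : A.carrier, 0 ≤ a ∧ ‖(a : A.Compl) - x‖ < ε := by
  obtain ⟨_, ⟨a, ha, rfl⟩, hxa⟩ := Metric.mem_closure_iff.1 hx ε hε
  exact ⟨a, ha, by rwa [dist_comm, dist_eq_norm] at hxa⟩

theorem norm_coe_ordUnit : ‖((ordUnit : A.carrier) : A.Compl)‖ = 1 := by
  rw [UniformSpace.Completion.norm_coe, norm_ordUnit]

theorem norm_smul_coe_ordUnit {r : ℝ} (hr : 0 ≤ r) :
    ‖r • ((ordUnit : A.carrier) : A.Compl)‖ = r := by
  rw [norm_smul, norm_coe_ordUnit, mul_one, Real.norm_eq_abs, abs_of_nonneg hr]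

theorem mem_complPos_iff {x : A.Compl} {r : ℝ} (hr : ‖x‖ ≤ r) :
    x ∈ A.complPos ↔ ‖r • ((ordUnit : A.carrier) : A.Compl) - x‖ ≤ r := by
  have hr0 : 0 ≤ r := (norm_nonneg x).trans hr
  constructor
  · intro hx
    refine le_of_forall_pos_le_add fun δ hδ => ?_
    obtain ⟨a, ha, hax⟩ := exists_nonneg_norm_sub_lt hx (ε := δ / 3) (by positivity)
    have h1 : ‖a‖ ≤ r + δ / 3 := by
      rw [← UniformSpace.Completion.norm_coe (E := A.carrier)]
      have := norm_sub_norm_le (a : A.Compl) x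
      linarith
    have h2 := (nonneg_iff_norm h1).1 ha
    rw [← UniformSpace.Completion.norm_coe, UniformSpace.Completion.coe_sub,
      UniformSpace.Completion.coe_smul] at h2
    have h3 : r • ((ordUnit : A.carrier) : A.Compl) - x =
        ((r + δ / 3) • ((ordUnit : A.carrier) : A.Compl) - (a : A.Compl)) +
          (((a : A.Compl) - x) - (δ / 3) • ((ordUnit : A.carrier) : A.Compl)) := by
      rw [add_smul]; abel
    have h4 := norm_sub_le ((a : A.Compl) - x) ((δ / 3) • ((ordUnit : A.carrier) : A.Compl))
    rw [norm_smul_coe_ordUnit (by positivity)] at h4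
    rw [h3]
    refine (norm_add_le _ _).trans ?_
    linarith
  · intro hx
    refine Metric.mem_closure_iff.2 fun ε hε => ?_
    obtain ⟨a, hax⟩ := exists_norm_sub_lt x (half_pos hε)
    have h1 : ‖r • (ordUnit : A.carrier) - a‖ ≤ r + ε / 2 := by
      rw [← UniformSpace.Completion.norm_coe, UniformSpace.Completion.coe_sub,
        UniformSpace.Completion.coe_smul,
        show r • ((ordUnit : A.carrier) : A.Compl) - (a : A.Compl) =
          (r • ((ordUnit : A.carrier) : A.Compl) - x) - ((a : A.Compl) - x) by abel]
      exact (norm_sub_le _ _).trans (add_le_add hx hax.le)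
    have h2 := (norm_le_iff.1 h1).2
    rw [add_smul, sub_le_iff_le_add, add_assoc, le_add_iff_nonneg_right] at h2
    -- The positive approximant is `(ε / 2) e + a`, with `a` within `ε / 2` of `x`.
    refine ⟨_, ⟨_, h2, rfl⟩, ?_⟩
    rw [dist_comm, dist_eq_norm]
    simp only [UniformSpace.Completion.coe_add]
    rw [UniformSpace.Completion.coe_smul,
      add_sub_assoc]
    refine (norm_add_le _ _).trans_lt ?_
    rw [norm_smul_coe_ordUnit (by positivity)]
    linarith

theorem norm_sub_le_norm_add {x y : A.Compl} (hx : x ∈ A.complPos) (hy : y ∈ A.complPos) :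
    ‖x - y‖ ≤ ‖x + y‖ := by
  have hmem : (x, y) ∈ closure (((fun a : A.carrier => (a : A.Compl)) '' {a | 0 ≤ a}) ×ˢ
      ((fun a : A.carrier => (a : A.Compl)) '' {a | 0 ≤ a})) := by
    rw [closure_prod_eq]
    exact ⟨hx, hy⟩
  refine closure_minimal (t := {p : A.Compl × A.Compl | ‖p.1 - p.2‖ ≤ ‖p.1 + p.2‖}) ?_
    (isClosed_le (by fun_prop) (by fun_prop)) hmem
  rintro ⟨_, _⟩ ⟨⟨a, ha, rfl⟩, ⟨b, hb, rfl⟩⟩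
  simp only [Set.mem_ofPred_eq] at ha hb ⊢
  rw [← UniformSpace.Completion.coe_sub, ← UniformSpace.Completion.coe_add,
    UniformSpace.Completion.norm_coe, UniformSpace.Completion.norm_coe, norm_le_iff]
  have h := le_norm_smul (a + b)
  constructor
  · rw [neg_le, neg_sub]
    exact (sub_le_self b ha).trans ((le_add_of_nonneg_left ha).trans h)
  · exact (sub_le_self a hb).trans ((le_add_of_nonneg_right hb).trans h)

/-- The cone and the unit determine the norm, so an isometry preserves norms. In one direction `re ±
x` are positive by `mem_complPos_iff` at radius `2r`; in the other, `2x` and `2re` are the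
difference and the sum of two positive elements. -/
theorem norm_le_iff_complPos {x : A.Compl} {r : ℝ} (hr : 0 ≤ r) :
    ‖x‖ ≤ r ↔ r • ((ordUnit : A.carrier) : A.Compl) - x ∈ A.complPos ∧
      r • ((ordUnit : A.carrier) : A.Compl) + x ∈ A.complPos := by
  set e := ((ordUnit : A.carrier) : A.Compl)
  constructor
  · have key : ∀ y : A.Compl, ‖y‖ ≤ r → r • e + y ∈ A.complPos := fun y hy => by
      have h1 : ‖r • e + y‖ ≤ 2 * r := by
        refine (norm_add_le _ _).trans ?_
        rw [norm_smul_coe_ordUnit hr]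
        linarith
      have h2 : ‖r • e - y‖ ≤ 2 * r := by
        refine (norm_sub_le _ _).trans ?_
        rw [norm_smul_coe_ordUnit hr]
        linarith
      rw [mem_complPos_iff h1]
      convert h2 using 2
      rw [two_mul, add_smul]
      abel
    intro h
    exact ⟨sub_eq_add_neg (r • e) x ▸ key (-x) (by rwa [norm_neg]), key x h⟩
  · rintro ⟨h1, h2⟩
    have h := norm_sub_le_norm_add h2 h1
    rw [show r • e + x - (r • e - x) = (2 : ℝ) • x by rw [two_smul]; abel,
      show r • e + x + (r • e - x) = (2 : ℝ) • r • e by rw [two_smul]; abel, norm_smul, norm_smul,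
      norm_smul_coe_ordUnit hr] at h
    exact le_of_mul_le_mul_left h (by simp)

theorem coe_mem_closedLipBall {a : A.carrier} (ha : A.lip a ≤ 1) :
    (a : A.Compl) ∈ A.closedLipBall :=
  subset_closure ⟨a, ha, rfl⟩

theorem convex_closedLipBall (A : CompactQuantumMetricSpace.{u}) : Convex ℝ A.closedLipBall := by
  refine Convex.closure ?_
  have h : Convex ℝ {a | A.lip a ≤ 1} := by
    have := A.lip.convex_closedBall 0 1
    rwa [Seminorm.closedBall_zero_eq] at this
  exact h.linear_image (UniformSpace.Completion.toComplL (𝕜 := ℝ) (E := A.carrier)).toLinearMap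

theorem smul_mem_closedLipBall {x : A.Compl} (hx : x ∈ A.closedLipBall) {t : ℝ} (ht : |t| ≤ 1) :
    t • x ∈ A.closedLipBall := by
  refine map_mem_closure (continuous_const_smul t) hx ?_
  rintro _ ⟨a, ha, rfl⟩
  refine ⟨t • a, ?_, UniformSpace.Completion.coe_smul t a⟩
  rw [Set.mem_ofPred_eq, map_smul_eq_mul, Real.norm_eq_abs]
  exact mul_le_one₀ ht (apply_nonneg _ _) ha

/-- The ball is convex and balanced, so its positive multiples already form a subspace. -/
theorem mem_closureDomain_iff {x : A.Compl} :
    x ∈ A.closureDomain ↔ ∃ r : ℝ, 0 < r ∧ x ∈ r • A.closedLipBall := by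
  constructor
  · intro hx
    induction hx using Submodule.span_induction with
    | mem x h => exact ⟨1, one_pos, by rwa [one_smul]⟩
    | zero =>
      refine ⟨1, one_pos, ?_⟩
      rw [one_smul]
      exact coe_mem_closedLipBall (a := 0) (by simp)
    | add x y _ _ hx hy =>
      obtain ⟨r, hr, hx⟩ := hx
      obtain ⟨s, hs, hy⟩ := hy
      refine ⟨r + s, add_pos hr hs, ?_⟩
      rw [A.convex_closedLipBall.add_smul hr.le hs.le]
      exact Set.add_mem_add hx hy
    | smul t x _ hx =>
      obtain ⟨r, hr, y, hy, rfl⟩ := hx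
      have hpos : 0 < |t| + 1 := by positivity
      refine ⟨(|t| + 1) * r, by positivity, (t / (|t| + 1)) • y, smul_mem_closedLipBall hy ?_, ?_⟩
      · rw [abs_div, abs_of_pos hpos, div_le_one hpos]
        linarith
      · change ((|t| + 1) * r) • (t / (|t| + 1)) • y = t • r • y
        rw [smul_smul, smul_smul]
        congr 1
        field_simp
  · rintro ⟨r, -, y, hy, rfl⟩
    exact A.closureDomain.smul_mem r (Submodule.subset_span hy)

/-- Since `s⁻¹ x` is in the ball for every `s > 1`, closedness gives the case `s = 1`. -/
theorem mem_closedLipBall_of_gauge_le {x : A.Compl} (hx : x ∈ A.closureDomain)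
    (h : gauge A.closedLipBall x ≤ 1) : x ∈ A.closedLipBall := by
  have key : ∀ s : ℝ, 1 < s → s⁻¹ • x ∈ A.closedLipBall := fun s hs => by
    rw [gauge_def] at h
    obtain ⟨r, ⟨hr, y, hy, rfl⟩, hrs⟩ := exists_lt_of_csInf_lt
      (mem_closureDomain_iff.1 hx) (h.trans_lt hs)
    have hs0 : 0 < s := one_pos.trans hs
    have hr0 : 0 < r := hr
    change s⁻¹ • r • y ∈ _
    rw [smul_smul]
    refine smul_mem_closedLipBall hy ?_
    rw [abs_of_pos (by positivity), inv_mul_le_iff₀ hs0, mul_one]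
    exact hrs.le
  have hlim : Filter.Tendsto (fun s : ℝ => s⁻¹ • x) (𝓝[>] 1) (𝓝 x) := by
    have h1 : Filter.Tendsto (fun s : ℝ => s⁻¹ • x) (𝓝 1) (𝓝 ((1 : ℝ)⁻¹ • x)) :=
      (tendsto_inv₀ one_ne_zero).smul_const x
    rw [inv_one, one_smul] at h1
    exact h1.mono_left nhdsWithin_le_nhds
  exact isClosed_closure.mem_of_tendsto hlim
    (Filter.eventually_of_mem self_mem_nhdsWithin fun s hs => key s hs)

theorem coe_mem_closureDomain (a : A.carrier) : (a : A.Compl) ∈ A.closureDomain := by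
  have hpos : 0 < A.lip a + 1 := by positivity
  refine mem_closureDomain_iff.2 ⟨A.lip a + 1, hpos, ((A.lip a + 1)⁻¹ • a : A.carrier),
    coe_mem_closedLipBall ?_, ?_⟩
  · rw [map_smul_eq_mul, Real.norm_eq_abs, abs_of_pos (inv_pos.2 hpos), inv_mul_le_iff₀ hpos]
    linarith
  · change (A.lip a + 1) • (((A.lip a + 1)⁻¹ • a : A.carrier) : A.Compl) = a
    rw [UniformSpace.Completion.coe_smul, smul_inv_smul₀ hpos.ne']

/-- The inclusion of `A` into the domain of its closure. -/
noncomputable def toClosureDomain (A : CompactQuantumMetricSpace.{u}) :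
    A.carrier →ₗ[ℝ] A.closureDomain :=
  (UniformSpace.Completion.toComplL (𝕜 := ℝ) (E := A.carrier)).toLinearMap.codRestrict
    A.closureDomain coe_mem_closureDomain

theorem coe_toClosureDomain (a : A.carrier) : (A.toClosureDomain a : A.Compl) = a := rfl

theorem Isometry.norm_map (f : Isometry A B) (x : A.closureDomain) :
    ‖(f.toEquiv x : B.Compl)‖ = ‖(x : A.Compl)‖ := by
  have h1 : ∀ r : ℝ, 0 ≤ r → (‖(f.toEquiv x : B.Compl)‖ ≤ r ↔ ‖(x : A.Compl)‖ ≤ r) := by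
    intro r hr
    rw [norm_le_iff_complPos hr, norm_le_iff_complPos hr]
    have h2 := f.map_pos (r • A.closureUnit - x)
    have h3 := f.map_pos (r • A.closureUnit + x)
    rw [map_sub, map_smul, f.map_unit] at h2
    rw [map_add, map_smul, f.map_unit] at h3
    exact and_congr h2 h3
  exact le_antisymm ((h1 _ (norm_nonneg _)).2 le_rfl) ((h1 _ (norm_nonneg _)).1 le_rfl)

theorem Isometry.mem_closedLipBall_iff (f : Isometry A B) (x : A.closureDomain) :
    (f.toEquiv x : B.Compl) ∈ B.closedLipBall ↔ (x : A.Compl) ∈ A.closedLipBall := by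
  have h := f.map_lip x
  constructor
  · intro hx
    exact mem_closedLipBall_of_gauge_le x.2 (h.trans_le (gauge_le_one_of_mem hx))
  · intro hx
    exact mem_closedLipBall_of_gauge_le (f.toEquiv x).2 (h.symm.trans_le (gauge_le_one_of_mem hx))

/-- With `N(a, b) = ‖φ(a) - b‖` in the completion of `B`, the closures of the two Lip-balls
correspond, so the balls themselves are within every `γ > 0`. -/
theorem Isometry.distq_eq_zero (f : Isometry A B) : distq A B = 0 := by
  let j : A.carrier →ₗ[ℝ] B.Compl :=
    B.closureDomain.subtype ∘ₗ f.toEquiv.toLinearMap ∘ₗ A.toClosureDomain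
  have hj : ∀ a, j a = f.toEquiv (A.toClosureDomain a) := fun a => rfl
  let N : Seminorm ℝ (A.carrier × B.carrier) := (normSeminorm ℝ B.Compl).comp
    (j ∘ₗ LinearMap.fst ℝ _ _ -
      (UniformSpace.Completion.toComplL (𝕜 := ℝ) (E := B.carrier)).toLinearMap ∘ₗ
        LinearMap.snd ℝ _ _)
  have hN : ∀ a b, N (a, b) = ‖j a - (b : B.Compl)‖ := fun a b => rfl
  have hb : ∀ γ : ℝ, 0 < γ → ∃ L, IsBridge A B γ L := by
    intro γ hγ
    refine exists_isBridge_of_seminorm N (fun a => ?_) (fun b => ?_) ?_ hγ (fun a ha => ?_)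
      (fun b hb => ?_)
    · rw [hN, UniformSpace.Completion.coe_zero, sub_zero, hj, f.norm_map, coe_toClosureDomain,
        UniformSpace.Completion.norm_coe]
    · rw [hN, map_zero, zero_sub, norm_neg, UniformSpace.Completion.norm_coe]
    · have h1 : j ordUnit = ((ordUnit : B.carrier) : B.Compl) :=
        congrArg Subtype.val f.map_unit
      rw [hN, h1, sub_self, norm_zero]
    · have h1 : j a ∈ B.closedLipBall :=
        (f.mem_closedLipBall_iff _).2 (coe_mem_closedLipBall ha)
      obtain ⟨_, ⟨b, hb, rfl⟩, hab⟩ := Metric.mem_closure_iff.1 h1 γ hγ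
      rw [dist_eq_norm] at hab
      exact ⟨b, hb, hab.le⟩
    · have h1 : (f.toEquiv.symm (B.toClosureDomain b) : A.Compl) ∈ A.closedLipBall := by
        rw [← f.mem_closedLipBall_iff, LinearEquiv.apply_symm_apply]
        exact coe_mem_closedLipBall hb
      obtain ⟨_, ⟨a, ha, rfl⟩, hab⟩ := Metric.mem_closure_iff.1 h1 γ hγ
      refine ⟨a, ha, ?_⟩
      have h2 := f.norm_map (A.toClosureDomain a - f.toEquiv.symm (B.toClosureDomain b))
      rw [map_sub, LinearEquiv.apply_symm_apply] at h2
      refine le_of_eq_of_le h2 ?_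
      rw [dist_comm, dist_eq_norm] at hab
      exact hab.le
  refine le_antisymm (ENNReal.le_of_forall_pos_le_add fun ε hε _ => ?_) bot_le
  obtain ⟨L, hL⟩ := hb ε hε
  rw [zero_add, ← ENNReal.ofReal_coe_nnreal]
  exact hL.distq_le ε.2

end Completion

end CompactQuantumMetricSpace

/-! ### Spaces at distance zero are isometric: ultrafilter limits of bridges -/

namespace CompactQuantumMetricSpace

variable {A B : CompactQuantumMetricSpace.{u}}

theorem IsBridge.norm_fst_le {r : ℝ} {L : Seminorm ℝ (A.carrier × B.carrier)}
    (h : IsBridge A B r L) (a : A.carrier) (b : B.carrier) : ‖a‖ ≤ ‖b‖ + r * L (a, b) := by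
  refine norm_le_of_forall_state fun μ => ?_
  obtain ⟨ν, hν⟩ := h.exists_state_snd μ
  have h1 := abs_sub_abs_le_abs_sub ((μ : WeakDual ℝ A.carrier) a) ((ν : WeakDual ℝ B.carrier) b)
  linarith [hν a b, abs_state_le ν b]

/-- Shrinking slightly makes the bound strict, as lifting through a bridge requires. -/
theorem exists_lip_lt_one_norm_sub_lt {x : A.Compl} (hx : x ∈ A.closedLipBall) {ε : ℝ}
    (hε : 0 < ε) : ∃ a : A.carrier, A.lip a < 1 ∧ ‖(a : A.Compl) - x‖ < ε := by
  obtain ⟨_, ⟨a, ha, rfl⟩, hax⟩ := Metric.mem_closure_iff.1 hx (ε / 2) (half_pos hε)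
  have hlim : Filter.Tendsto (fun t : ℝ => ((t • a : A.carrier) : A.Compl)) (𝓝[<] 1)
      (𝓝 ((a : A.carrier) : A.Compl)) := by
    have h1 : Filter.Tendsto (fun t : ℝ => t • (a : A.Compl)) (𝓝 1) (𝓝 ((1 : ℝ) • (a : A.Compl))) :=
      (continuous_id.smul continuous_const).tendsto 1
    rw [one_smul] at h1
    simpa only [UniformSpace.Completion.coe_smul] using h1.mono_left nhdsWithin_le_nhds
  obtain ⟨t, ht, ht0, ht1⟩ := ((Metric.tendsto_nhds.1 hlim (ε / 2) (half_pos hε)).and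
    (Ioo_mem_nhdsLT (zero_lt_one (α := ℝ)))).exists
  refine ⟨t • a, ?_, ?_⟩
  · rw [map_smul_eq_mul, Real.norm_eq_abs, abs_of_pos ht0]
    exact (mul_le_of_le_one_right ht0.le ha).trans_lt ht1
  · rw [← dist_eq_norm]
    refine (dist_triangle _ (a : A.Compl) _).trans_lt ?_
    rw [dist_comm] at hax
    linarith

theorem isCompact_closure_lipBall (A : CompactQuantumMetricSpace.{u}) (R : ℝ) :
    IsCompact (closure ((fun a : A.carrier => (a : A.Compl)) '' {a | A.lip a ≤ 1 ∧ ‖a‖ ≤ R})) := by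
  obtain ⟨μ₀⟩ := nonempty_stateSpace (A := A.carrier)
  have hI := (isCompact_Icc (a := -R) (b := R)).totallyBounded
  let Ψ : A.carrier × ℝ →L[ℝ] A.carrier := ContinuousLinearMap.fst ℝ _ _ +
    (ContinuousLinearMap.snd ℝ A.carrier ℝ).smulRight ordUnit
  have h1 : TotallyBounded {a : A.carrier | A.lip a ≤ 1 ∧ ‖a‖ ≤ R} := by
    refine (((A.isLipNorm.totallyBounded μ₀).setProd hI).image Ψ.uniformContinuous).subset ?_
    rintro a ⟨ha, hR⟩
    set s := (μ₀ : WeakDual ℝ A.carrier) a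
    refine ⟨(a - s • ordUnit, s), ⟨⟨?_, ?_⟩, ?_⟩, ?_⟩
    · rw [sub_eq_add_neg, ← neg_smul, seminorm_add_smul_ordUnit A.isLipNorm.map_ordUnit]
      exact ha
    · rw [map_sub, map_smul, state_ordUnit, smul_eq_mul, mul_one, sub_self]
    · exact abs_le.1 ((abs_state_le μ₀ a).trans hR)
    · simp [Ψ]
  exact ((h1.image (UniformSpace.Completion.uniformContinuous_coe _)).closure).isCompact_of_isClosed
    isClosed_closure

/-- The limit along an ultrafilter of the unit balls of seminorms on `A ⊕ B`. -/
def limitBall (L : ℕ → Seminorm ℝ (A.carrier × B.carrier)) : Set (A.Compl × B.Compl) :=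
  {p | ∀ ε > 0, ∀ᶠ n in Filter.hyperfilter ℕ, ∃ a b, L n (a, b) ≤ 1 ∧
    ‖((a : A.carrier) : A.Compl) - p.1‖ < ε ∧ ‖((b : B.carrier) : B.Compl) - p.2‖ < ε}

section Limit

variable {L : ℕ → Seminorm ℝ (A.carrier × B.carrier)}

theorem swap_mem_limitBall {p : A.Compl × B.Compl} (hp : p ∈ limitBall (A := A) (B := B) L) :
    p.swap ∈ limitBall (A := B) (B := A)
      fun n => (L n).comp (LinearEquiv.prodComm ℝ B.carrier A.carrier).toLinearMap := by
  intro ε hε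
  filter_upwards [hp ε hε] with n ⟨a, b, h, ha, hb⟩
  exact ⟨b, a, h, hb, ha⟩

theorem smul_add_smul_mem_limitBall {p q : A.Compl × B.Compl}
    (hp : p ∈ limitBall (A := A) (B := B) L)
    (hq : q ∈ limitBall (A := A) (B := B) L) {s t : ℝ} (hst : |s| + |t| ≤ 1) :
    s • p + t • q ∈ limitBall (A := A) (B := B) L := by
  intro ε hε
  have est : ∀ {E : Type u} [NormedAddCommGroup E] [NormedSpace ℝ E] (x y x' y' : E),
      ‖x - x'‖ < ε / 2 → ‖y - y'‖ < ε / 2 → ‖(s • x + t • y) - (s • x' + t • y')‖ < ε := by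
    intro E _ _ x y x' y' hx hy
    rw [add_sub_add_comm, ← smul_sub, ← smul_sub]
    refine (norm_add_le _ _).trans_lt ?_
    rw [norm_smul, norm_smul, Real.norm_eq_abs, Real.norm_eq_abs]
    have h1 := mul_le_mul_of_nonneg_left hx.le (abs_nonneg s)
    have h2 := mul_le_mul_of_nonneg_left hy.le (abs_nonneg t)
    nlinarith
  filter_upwards [hp (ε / 2) (half_pos hε), hq (ε / 2) (half_pos hε)] with n
    ⟨a, b, h, ha, hb⟩ ⟨a', b', h', ha', hb'⟩
  refine ⟨s • a + t • a', s • b + t • b', ?_, ?_, ?_⟩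
  · have h1 : ((s • a + t • a', s • b + t • b') : A.carrier × B.carrier) =
        s • (a, b) + t • (a', b') := rfl
    rw [h1]
    refine (map_add_le_add (L n) _ _).trans ?_
    rw [map_smul_eq_mul, map_smul_eq_mul, Real.norm_eq_abs, Real.norm_eq_abs]
    have h2 := mul_le_of_le_one_right (abs_nonneg s) h
    have h3 := mul_le_of_le_one_right (abs_nonneg t) h'
    linarith
  · rw [UniformSpace.Completion.coe_add, UniformSpace.Completion.coe_smul,
      UniformSpace.Completion.coe_smul]
    exact est _ _ _ _ ha ha'
  · rw [UniformSpace.Completion.coe_add, UniformSpace.Completion.coe_smul,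
      UniformSpace.Completion.coe_smul]
    exact est _ _ _ _ hb hb'

variable {r : ℕ → ℝ}

theorem smul_ordUnit_mem_limitBall (hL : ∀ n, IsBridge A B (r n) (L n)) (c : ℝ) :
    (c • ((ordUnit : A.carrier) : A.Compl), c • ((ordUnit : B.carrier) : B.Compl)) ∈
      limitBall (A := A) (B := B) L := by
  intro ε hε
  refine Filter.Eventually.of_forall fun n => ⟨c • ordUnit, c • ordUnit, ?_, ?_, ?_⟩
  · have h : ((c • ordUnit, c • ordUnit) : A.carrier × B.carrier) = c • (ordUnit, ordUnit) := rfl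
    rw [h, map_smul_eq_mul, (hL n).map_unit, mul_zero]
    exact zero_le_one
  · rw [UniformSpace.Completion.coe_smul, sub_self, norm_zero]
    exact hε
  · rw [UniformSpace.Completion.coe_smul, sub_self, norm_zero]
    exact hε

theorem fst_mem_of_mem_limitBall (hL : ∀ n, IsBridge A B (r n) (L n)) {p : A.Compl × B.Compl}
    (hp : p ∈ limitBall (A := A) (B := B) L) : p.1 ∈ A.closedLipBall := by
  refine Metric.mem_closure_iff.2 fun ε hε => ?_
  obtain ⟨n, a, b, h, ha, -⟩ := (hp ε hε).exists
  refine ⟨_, ⟨a, ((hL n).fst_le a b).trans h, rfl⟩, ?_⟩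
  rwa [dist_comm, dist_eq_norm]

/-- In the unit ball of the `n`-th bridge the norms differ by at most `r n`, which tends to zero.
Applied also to the swapped bridges, this makes the limit the graph of a norm-preserving map. -/
theorem norm_fst_le_of_mem_limitBall (hL : ∀ n, IsBridge A B (r n) (L n)) (hr : ∀ n, 0 ≤ r n)
    (hr0 : Filter.Tendsto r Filter.atTop (𝓝 0)) {p : A.Compl × B.Compl}
    (hp : p ∈ limitBall (A := A) (B := B) L) : ‖p.1‖ ≤ ‖p.2‖ := by
  refine le_of_forall_pos_le_add fun ε hε => ?_
  have h1 : ∀ᶠ n in Filter.hyperfilter ℕ, r n < ε / 3 :=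
    (hr0.mono_left Nat.hyperfilter_le_atTop).eventually_lt_const (by positivity)
  obtain ⟨n, ⟨a, b, h, ha, hb⟩, hn⟩ := ((hp (ε / 3) (by positivity)).and h1).exists
  have h2 := (hL n).norm_fst_le a b
  rw [← UniformSpace.Completion.norm_coe, ← UniformSpace.Completion.norm_coe (E := B.carrier)] at h2
  have h3 := mul_le_of_le_one_right (hr n) h
  have h4 := norm_sub_norm_le p.1 (a : A.Compl)
  rw [norm_sub_rev] at h4
  have h5 := norm_sub_norm_le (b : B.Compl) p.2
  linarith

theorem exists_mem_limitBall (hL : ∀ n, IsBridge A B (r n) (L n)) (hr : ∀ n, 0 ≤ r n)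
    (hr0 : Filter.Tendsto r Filter.atTop (𝓝 0)) {x : A.Compl} (hx : x ∈ A.closedLipBall) :
    ∃ y, (x, y) ∈ limitBall (A := A) (B := B) L := by
  choose a ha hax using fun n : ℕ =>
    exists_lip_lt_one_norm_sub_lt hx (Nat.one_div_pos_of_nat (α := ℝ) (n := n))
  choose b hb using fun n => (hL n).exists_snd (a n) 1 (ha n)
  obtain ⟨M, hM⟩ := hr0.bddAbove_range
  have hbnorm : ∀ n, ‖b n‖ ≤ ‖x‖ + 1 + M := fun n => by
    have h1 := (hL n).symm.norm_fst_le (b n) (a n)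
    have h2 := mul_le_of_le_one_right (hr n) (hb n).le
    have h3 := hM ⟨n, rfl⟩
    have h4 := norm_sub_norm_le (a n : A.Compl) x
    rw [UniformSpace.Completion.norm_coe] at h4
    have h5 : 1 / ((n : ℝ) + 1) ≤ 1 := by
      rw [div_le_one (by positivity)]
      linarith [(Nat.cast_nonneg n : (0 : ℝ) ≤ n)]
    have h6 := hax n
    change ‖b n‖ ≤ ‖a n‖ + r n * L n (a n, b n) at h1
    linarith
  -- The lifts stay in a relatively compact set, so they converge along the fixed ultrafilter. Using
  -- one ultrafilter for all `x` makes the limits linear without extracting subsequences.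
  obtain ⟨y, -, hy⟩ := (B.isCompact_closure_lipBall (‖x‖ + 1 + M)).ultrafilter_le_nhds
    ((Filter.hyperfilter ℕ).map fun n => (b n : B.Compl))
    (Filter.le_principal_iff.2 (Filter.mem_map.2 (Filter.univ_mem' fun n =>
      subset_closure ⟨b n, ⟨((hL n).snd_le _ _).trans (hb n).le, hbnorm n⟩, rfl⟩)))
  refine ⟨y, fun ε hε => ?_⟩
  have h1 : ∀ᶠ n in Filter.hyperfilter ℕ, ‖(b n : B.Compl) - y‖ < ε := by
    filter_upwards [Filter.mem_map.1 (hy (Metric.ball_mem_nhds y hε))] with n hn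
    exact mem_ball_iff_norm.1 hn
  have h2 : ∀ᶠ n : ℕ in Filter.hyperfilter ℕ, 1 / ((n : ℝ) + 1) < ε :=
    (tendsto_one_div_add_atTop_nhds_zero_nat.mono_left
      Nat.hyperfilter_le_atTop).eventually_lt_const hε
  filter_upwards [h1, h2] with n hn1 hn2
  exact ⟨a n, b n, (hb n).le, (hax n).trans hn2, hn1⟩

/-- The cone over `limitBall`, which is the graph of an isometry. -/
noncomputable def limitGraph (hL : ∀ n, IsBridge A B (r n) (L n)) :
    Submodule ℝ (A.Compl × B.Compl) where
  carrier := {p | ∃ s : ℝ, 0 < s ∧ p ∈ s • limitBall (A := A) (B := B) L}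
  zero_mem' := by
    refine ⟨1, one_pos, ?_⟩
    have := smul_ordUnit_mem_limitBall hL 0
    rw [zero_smul, zero_smul] at this
    rwa [one_smul]
  add_mem' := by
    rintro _ _ ⟨s, hs, p, hp, rfl⟩ ⟨t, ht, q, hq, rfl⟩
    have hst : 0 < s + t := add_pos hs ht
    refine ⟨s + t, hst, (s / (s + t)) • p + (t / (s + t)) • q,
      smul_add_smul_mem_limitBall hp hq ?_, ?_⟩
    · rw [abs_of_pos (by positivity), abs_of_pos (by positivity), ← add_div, div_self hst.ne']
    · change (s + t) • ((s / (s + t)) • p + (t / (s + t)) • q) = s • p + t • q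
      rw [smul_add, smul_smul, smul_smul, mul_div_cancel₀ _ hst.ne', mul_div_cancel₀ _ hst.ne']
  smul_mem' := by
    rintro c _ ⟨s, hs, p, hp, rfl⟩
    have hc : 0 < |c| + 1 := by positivity
    refine ⟨(|c| + 1) * s, by positivity, (c / (|c| + 1)) • p, ?_, ?_⟩
    · have := smul_add_smul_mem_limitBall hp hp (s := c / (|c| + 1)) (t := 0) (by
        rw [abs_zero, add_zero, abs_div, abs_of_pos hc, div_le_one hc]
        linarith)
      rwa [zero_smul, add_zero] at this
    · change ((|c| + 1) * s) • (c / (|c| + 1)) • p = c • s • p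
      rw [smul_smul, smul_smul]
      congr 1
      field_simp

theorem mem_limitGraph_of_mem_limitBall (hL : ∀ n, IsBridge A B (r n) (L n))
    {p : A.Compl × B.Compl} (hp : p ∈ limitBall (A := A) (B := B) L) : p ∈ limitGraph hL :=
  ⟨1, one_pos, by rwa [one_smul]⟩

theorem swap_mem_limitGraph (hL : ∀ n, IsBridge A B (r n) (L n)) {p : A.Compl × B.Compl}
    (hp : p ∈ limitGraph hL) : p.swap ∈ limitGraph fun n => (hL n).symm := by
  obtain ⟨s, hs, q, hq, rfl⟩ := hp
  exact ⟨s, hs, q.swap, swap_mem_limitBall hq, rfl⟩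

theorem fst_mem_closureDomain (hL : ∀ n, IsBridge A B (r n) (L n)) {p : A.Compl × B.Compl}
    (hp : p ∈ limitGraph hL) : p.1 ∈ A.closureDomain := by
  obtain ⟨s, hs, q, hq, rfl⟩ := hp
  exact mem_closureDomain_iff.2 ⟨s, hs, q.1, fst_mem_of_mem_limitBall hL hq, rfl⟩

theorem norm_fst_le_of_mem_limitGraph (hL : ∀ n, IsBridge A B (r n) (L n)) (hr : ∀ n, 0 ≤ r n)
    (hr0 : Filter.Tendsto r Filter.atTop (𝓝 0)) {p : A.Compl × B.Compl}
    (hp : p ∈ limitGraph hL) : ‖p.1‖ ≤ ‖p.2‖ := by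
  obtain ⟨s, hs, q, hq, rfl⟩ := hp
  change ‖s • q.1‖ ≤ ‖s • q.2‖
  rw [norm_smul, norm_smul]
  exact mul_le_mul_of_nonneg_left (norm_fst_le_of_mem_limitBall hL hr hr0 hq) (norm_nonneg s)

theorem exists_mem_limitGraph (hL : ∀ n, IsBridge A B (r n) (L n)) (hr : ∀ n, 0 ≤ r n)
    (hr0 : Filter.Tendsto r Filter.atTop (𝓝 0)) {x : A.Compl} (hx : x ∈ A.closureDomain) :
    ∃ y, (x, y) ∈ limitGraph hL := by
  obtain ⟨s, hs, x, hx', rfl⟩ := mem_closureDomain_iff.1 hx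
  obtain ⟨y, hy⟩ := exists_mem_limitBall hL hr hr0 hx'
  exact ⟨s • y, s, hs, (x, y), hy, rfl⟩

theorem norm_eq_of_mem_limitGraph (hL : ∀ n, IsBridge A B (r n) (L n)) (hr : ∀ n, 0 ≤ r n)
    (hr0 : Filter.Tendsto r Filter.atTop (𝓝 0)) {p : A.Compl × B.Compl}
    (hp : p ∈ limitGraph hL) : ‖p.1‖ = ‖p.2‖ :=
  le_antisymm (norm_fst_le_of_mem_limitGraph hL hr hr0 hp)
    (norm_fst_le_of_mem_limitGraph (fun n => (hL n).symm) hr hr0 (swap_mem_limitGraph hL hp))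

/-- The projection of `limitGraph` to the domain of the closure of `A`. -/
noncomputable def limitFst (hL : ∀ n, IsBridge A B (r n) (L n)) :
    limitGraph hL →ₗ[ℝ] A.closureDomain :=
  (LinearMap.fst ℝ A.Compl B.Compl ∘ₗ (limitGraph hL).subtype).codRestrict _
    fun p => fst_mem_closureDomain hL p.2

/-- The projection of `limitGraph` to the domain of the closure of `B`. -/
noncomputable def limitSnd (hL : ∀ n, IsBridge A B (r n) (L n)) :
    limitGraph hL →ₗ[ℝ] B.closureDomain :=
  (LinearMap.snd ℝ A.Compl B.Compl ∘ₗ (limitGraph hL).subtype).codRestrict _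
    fun p => fst_mem_closureDomain (fun n => (hL n).symm) (swap_mem_limitGraph hL p.2)

theorem bijective_limitFst (hL : ∀ n, IsBridge A B (r n) (L n)) (hr : ∀ n, 0 ≤ r n)
    (hr0 : Filter.Tendsto r Filter.atTop (𝓝 0)) : Function.Bijective (limitFst hL) := by
  constructor
  · rw [injective_iff_map_eq_zero]
    rintro ⟨⟨x, y⟩, hp⟩ h
    obtain rfl : x = 0 := congrArg Subtype.val h
    have h1 := norm_eq_of_mem_limitGraph hL hr hr0 hp
    obtain rfl : y = 0 := norm_eq_zero.1 (h1.symm.trans norm_zero)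
    rfl
  · rintro ⟨x, hx⟩
    obtain ⟨y, hy⟩ := exists_mem_limitGraph hL hr hr0 hx
    exact ⟨⟨(x, y), hy⟩, rfl⟩

theorem bijective_limitSnd (hL : ∀ n, IsBridge A B (r n) (L n)) (hr : ∀ n, 0 ≤ r n)
    (hr0 : Filter.Tendsto r Filter.atTop (𝓝 0)) : Function.Bijective (limitSnd hL) := by
  constructor
  · rw [injective_iff_map_eq_zero]
    rintro ⟨⟨x, y⟩, hp⟩ h
    obtain rfl : y = 0 := congrArg Subtype.val h
    have h1 := norm_eq_of_mem_limitGraph hL hr hr0 hp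
    obtain rfl : x = 0 := norm_eq_zero.1 (h1.trans norm_zero)
    rfl
  · rintro ⟨y, hy⟩
    obtain ⟨x, hx⟩ := exists_mem_limitGraph (fun n => (hL n).symm) hr hr0 hy
    exact ⟨⟨(x, y), swap_mem_limitGraph (fun n => (hL n).symm) hx⟩, rfl⟩

theorem nonempty_isometry_of_isBridge (hL : ∀ n, IsBridge A B (r n) (L n)) (hr : ∀ n, 0 ≤ r n)
    (hr0 : Filter.Tendsto r Filter.atTop (𝓝 0)) : Nonempty (Isometry A B) := by
  obtain ⟨φ, hφ⟩ : ∃ φ : A.closureDomain ≃ₗ[ℝ] B.closureDomain,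
      ∀ x : A.closureDomain, ((x : A.Compl), (φ x : B.Compl)) ∈ limitGraph hL := by
    let e := LinearEquiv.ofBijective _ (bijective_limitFst hL hr hr0)
    refine ⟨e.symm.trans (LinearEquiv.ofBijective _ (bijective_limitSnd hL hr hr0)), fun x => ?_⟩
    obtain ⟨p, rfl⟩ := e.surjective x
    rw [LinearEquiv.trans_apply, LinearEquiv.symm_apply_apply]
    exact p.2
  -- The graph is a subspace on which the two coordinates have equal norms, so a point of it that
  -- agrees with `(x, φ x)` in one coordinate agrees in the other.
  have hdiff : ∀ (x : A.closureDomain) (p : A.Compl × B.Compl), p ∈ limitGraph hL →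
      ‖(x : A.Compl) - p.1‖ = ‖(φ x : B.Compl) - p.2‖ := fun x p hp =>
    norm_eq_of_mem_limitGraph hL hr hr0 ((limitGraph hL).sub_mem (hφ x) hp)
  have hunit : φ A.closureUnit = B.closureUnit := by
    have h1 := smul_ordUnit_mem_limitBall hL 1
    rw [one_smul, one_smul] at h1
    have h2 := hdiff A.closureUnit _ (mem_limitGraph_of_mem_limitBall hL h1)
    refine Subtype.ext (sub_eq_zero.1 (norm_eq_zero.1 (h2.symm.trans ?_)))
    exact norm_eq_zero.2 (sub_self _)
  have hnorm : ∀ x, ‖(φ x : B.Compl)‖ = ‖(x : A.Compl)‖ := fun x =>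
    (norm_eq_of_mem_limitGraph hL hr hr0 (hφ x)).symm
  refine ⟨⟨φ, hunit, fun x => ?_, fun x => ?_⟩⟩
  -- Positivity is a norm condition on `‖x‖ e - x`, which `φ` preserves.
  · rw [mem_complPos_iff (hnorm x).le, mem_complPos_iff (le_refl ‖(x : A.Compl)‖)]
    have h := hnorm (‖(x : A.Compl)‖ • A.closureUnit - x)
    rw [map_sub, map_smul, hunit] at h
    exact (congrArg (· ≤ ‖(x : A.Compl)‖) h).to_iff
  · have hball : ∀ x : A.closureDomain,
        (x : A.Compl) ∈ A.closedLipBall ↔ (φ x : B.Compl) ∈ B.closedLipBall := by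
      intro x
      constructor
      · intro hx
        obtain ⟨y, hy⟩ := exists_mem_limitBall hL hr hr0 hx
        have h1 := hdiff x _ (mem_limitGraph_of_mem_limitBall hL hy)
        rw [sub_self, norm_zero] at h1
        rw [sub_eq_zero.1 (norm_eq_zero.1 h1.symm)]
        exact fst_mem_of_mem_limitBall (fun n => (hL n).symm) (swap_mem_limitBall hy)
      · intro hx
        obtain ⟨z, hz⟩ := exists_mem_limitBall (fun n => (hL n).symm) hr hr0 hx
        have h0 : (z, (φ x : B.Compl)) ∈ limitBall (A := A) (B := B) L := swap_mem_limitBall hz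
        have h1 := hdiff x _ (mem_limitGraph_of_mem_limitBall hL h0)
        rw [sub_self, norm_zero] at h1
        rw [sub_eq_zero.1 (norm_eq_zero.1 h1)]
        exact fst_mem_of_mem_limitBall hL h0
    change gauge _ _ = gauge _ _
    rw [gauge_def, gauge_def]
    congr 1
    ext s
    refine and_congr_right fun hs => ?_
    have hs' : s ≠ 0 := (ne_of_gt hs : s ≠ 0)
    rw [Set.mem_smul_set_iff_inv_smul_mem₀ hs', Set.mem_smul_set_iff_inv_smul_mem₀ hs']
    have h := hball (s⁻¹ • x)
    rw [map_smul] at h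
    exact h

end Limit

theorem nonempty_isometry_of_distq_eq_zero (h : distq A B = 0) : Nonempty (Isometry A B) := by
  have hpos : ∀ n : ℕ, 0 < 1 / ((n : ℝ) + 1) := fun n => Nat.one_div_pos_of_nat
  choose L hL using fun n : ℕ => exists_isBridge_of_distq_lt (A := A) (B := B)
    (r := 1 / ((n : ℝ) + 1)) (h ▸ ENNReal.ofReal_pos.2 (hpos n))
  exact nonempty_isometry_of_isBridge hL (fun n => (hpos n).le)
    tendsto_one_div_add_atTop_nhds_zero_nat

/-! ### The metric on isometry classes -/

theorem distq_congr {A A' B B' : CompactQuantumMetricSpace.{u}} (f : Isometry A A')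
    (g : Isometry B B') : distq A B = distq A' B' := by
  have hf := f.distq_eq_zero
  have hg := g.distq_eq_zero
  apply le_antisymm
  · have h := (distq_triangle A A' B).trans (add_le_add_right (distq_triangle A' B' B) _)
    rwa [hf, distq_comm B', hg, zero_add, add_zero] at h
  · have h := (distq_triangle A' A B').trans (add_le_add_right (distq_triangle A B B') _)
    rwa [distq_comm A' A, hf, hg, zero_add, add_zero] at h

theorem exists_toClass_eq (x : IsometryClass.{u}) :
    ∃ A : CompactQuantumMetricSpace.{u}, A.toClass = x :=
  Quotient.exists_rep x

/-- The metric on isometry classes defined by `distq`. -/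
noncomputable abbrev isometryClassEMetricSpace : EMetricSpace IsometryClass.{u} where
  edist := Quotient.lift₂ distq fun _ _ _ _ ⟨f⟩ ⟨g⟩ => distq_congr f g
  edist_self := by
    rintro ⟨A⟩
    obtain ⟨f⟩ := isometrySetoid.refl A
    exact f.distq_eq_zero
  edist_comm := by
    rintro ⟨A⟩ ⟨B⟩
    exact distq_comm A B
  edist_triangle := by
    rintro ⟨A⟩ ⟨B⟩ ⟨C⟩
    exact distq_triangle A B C
  eq_of_edist_eq_zero := by
    rintro ⟨A⟩ ⟨B⟩ h
    exact Quotient.sound (nonempty_isometry_of_distq_eq_zero h)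

/-- The metric on isometry classes defined by `distq`, with finite distances. -/
noncomputable abbrev isometryClassMetricSpace : MetricSpace IsometryClass.{u} :=
  letI := isometryClassEMetricSpace.{u}
  EMetricSpace.toMetricSpace (by
    rintro ⟨A⟩ ⟨B⟩
    exact (distq_lt_top A B).ne)

end CompactQuantumMetricSpace

theorem theorem13p15 :
    ∃ _m : MetricSpace CompactQuantumMetricSpace.IsometryClass.{u},
      (∀ A B : CompactQuantumMetricSpace.{u},
        edist A.toClass B.toClass = CompactQuantumMetricSpace.distq A B) ∧
      TopologicalSpace.SeparableSpace CompactQuantumMetricSpace.IsometryClass.{u} := by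
  let m := CompactQuantumMetricSpace.isometryClassMetricSpace.{u}
  have hm : ∀ A B : CompactQuantumMetricSpace.{u}, edist A.toClass B.toClass = CompactQuantumMetricSpace.distq A B :=
    fun _ _ => rfl
  refine ⟨m, hm, ?_⟩
  -- The discretization need not be invariant under isometry, so it is evaluated on chosen
  -- representatives.
  choose rep hrep using CompactQuantumMetricSpace.exists_toClass_eq.{u}
  have : SecondCountableTopology CompactQuantumMetricSpace.IsometryClass.{u} :=
    Metric.secondCountable_of_countable_discretization fun ε hε => by
      obtain ⟨F, hF⟩ := CompactQuantumMetricSpace.exists_countable_discretization.{u} hε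
      refine ⟨ℕ × ℕ, inferInstance, fun x => F (rep x), fun x y hxy => ?_⟩
      have h := hF _ _ hxy
      rw [← hm, hrep, hrep, edist_dist] at h
      exact (ENNReal.ofReal_le_ofReal_iff hε.le).1 h
  infer_instance
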